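/- Consider a FCFS GI/GI/1 queue: packet $n$ ($n\in\mathbb Z$) arrives at time $\alpha_n$, has service time $H_n\ge 0$, and departs at time $\beta_n=\max(\beta_{n-1},\alpha_n)+H_n$, where $\alpha_{n-1}\le\alpha_n$; the service times $H_n$ are i.i.d. copies of $H$, the interarrival times $G_n=\alpha_n-\alpha_{n-1}$ ($n\neq 1$) are i.i.d. copies of $G$, and all these variables are mutually independent. (The interval $\alpha_1-\alpha_0$, which covers the origin in the time-stationary queue, is left unrestricted.) Assume $0<\mathrm E[G]<\infty$ and $\rho=\mathrm E[H]/\mathrm E[G]<1$. Let $D_n=\beta_n-\alpha_n$ be the system delay, let $A_t=t-\sup\{\alpha_n:\beta_n\le t\}$ be the age of information (AoI) at time $t$, and let $A_{\mathrm{peak},n}=\beta_n-\alpha_{n-1}$ be the $n$th peak AoI. Then there are non-negative random variables $D$, $A$, $A_{\mathrm{peak}}$ (the stationary delay, AoI and peak AoI) such that the following hold. (a) With probability one, for every $x\in\mathbb R$, \[ \frac1N\sum_{n=1}^N \mathbf 1_{\{D_n\le x\}}\to \Pr(D\le x),\qquad \frac1T\int_0^T \mathbf 1_{\{A_t\le x\}}\,\mathrm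 dt\to \Pr(A\le x),\qquad \frac1N\sum_{n=1}^N \mathbf 1_{\{A_{\mathrm{peak},n}\le x\}}\to \Pr(A_{\mathrm{peak}}\le x) \] as $N\to\infty$ and $T\to\infty$. (b) If the $D_n$ ($n\ge1$) are identically distributed, then each $D_n$ is distributed as $D$; if the $A_t$ ($t\ge0$) are identically distributed, then each $A_t$ is distributed as $A$; if the $A_{\mathrm{peak},n}$ ($n\ge1$) are identically distributed, then each $A_{\mathrm{peak},n}$ is distributed as $A_{\mathrm{peak}}$. (c) For a non-negative random variable $Y$, write $Y(x)=\Pr(Y\le x)$ for its distribution function and $y^*(s)=\mathrm E[e^{-sY}]$ for its Laplace–Stieltjes transform. For every $s>0$, \[ a^*(s)=\frac{d^*(s)-a_{\mathrm{peak}}^*(s)}{s\,\mathrm E[G]}, \] \[ a_{\mathrm{peak}}^*(s)=\Bigl[\int_0^\infty e^{-sx}G(x)\,\mathrm dD(x)+\int_0^\infty e^{-sx}D(x)\,\mathrm dG(x)-\mathrm E\bigl[\mathbf 1_{\{G=D\}}e^{-sG}\bigr]\Bigr]h^*(s), \] where the integrals include a possible atom at $0$ and, in the last expectation, $G$ and $D$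 are independent. -/

import Mathlib

open MeasureTheory ProbabilityTheory Filter Topology

noncomputable section

namespace AoI

/-- The Laplace–Stieltjes transform `E[exp (-s Y)]` of a random variable `Y` with law `μ`. -/
def lst (μ : Measure ℝ) (s : ℝ) : ℝ := ∫ y, Real.exp (-s * y) ∂μ

/-- System delay `D_n` of the `n`-th packet (`α n` its arrival time, `β n` its departure time). -/
def delay {Ω : Type*} (α β : ℤ → Ω → ℝ) (n : ℤ) (ω : Ω) : ℝ := β n ω - α n ω

/-- Interarrival time between the `(n-1)`-st and the `n`-th packet. -/
def interarrival {Ω : Type*} (α : ℤ → Ω → ℝ) (n : ℤ) (ω : Ω) : ℝ := α n ω - α (n - 1) ω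

/-- The time stamp of the information displayed at time `t`: the latest arrival time among the
packets that have departed by time `t`. -/
def timeStamp {Ω : Type*} (α β : ℤ → Ω → ℝ) (t : ℝ) (ω : Ω) : ℝ :=
  sSup {a : ℝ | ∃ n : ℤ, β n ω ≤ t ∧ a = α n ω}

/-- The age of information at time `t`. -/
def age {Ω : Type*} (α β : ℤ → Ω → ℝ) (t : ℝ) (ω : Ω) : ℝ := t - timeStamp α β t ω

/-- The `n`-th peak age of information: the age just before the `n`-th departure, when the
displayed information is that of the `(n-1)`-st packet. -/
def peakAge {Ω : Type*} (α β : ℤ → Ω → ℝ) (n : ℤ) (ω : Ω) : ℝ := β n ω - α (n - 1) ω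

/-- A FCFS GI/GI/1 queue on the whole time axis, with interarrival law `μG` and service law `μH`.
Packet `n` has arrival time `α n`, service time `H n` and departure time `β n`.
The interval between the arrivals of packets `0` and `1` is left unrestricted: in the queue that is
stationary in time it is the one that covers the time origin, hence is length-biased, while in the
queue that is stationary from packet to packet it has law `μG` like all the others.  Both versions
satisfy this definition. -/
structure IsFCFSQueue {Ω : Type*} [MeasurableSpace Ω] (P : Measure Ω) (μG μH : Measure ℝ)
    (α β H : ℤ → Ω → ℝ) : Prop where
  measurable_arrival : ∀ n, Measurable (α n)
  measurable_departure : ∀ n, Measurable (β n)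
  measurable_service : ∀ n, Measurable (H n)
  /-- Packets are numbered in the order of arrival. -/
  arrival_mono : ∀ᵐ ω ∂P, ∀ n, α (n - 1) ω ≤ α n ω
  service_nonneg : ∀ᵐ ω ∂P, ∀ n, 0 ≤ H n ω
  /-- A single server, first come first served: service of packet `n` starts as soon as the packet
  has arrived and packet `n - 1` has departed. -/
  fcfs : ∀ᵐ ω ∂P, ∀ n, β n ω = max (β (n - 1) ω) (α n ω) + H n ω
  interarrival_law : ∀ n, n ≠ 1 → HasLaw (interarrival α n) μG P
  service_law : ∀ n, HasLaw (H n) μH P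
  /-- Interarrival times and service times are mutually independent. -/
  indep : iIndepFun
    (Sum.elim (fun n : {n : ℤ // n ≠ 1} => interarrival α (n : ℤ)) H) P

/-- `μ` is the asymptotic frequency distribution of the path `f t`, `t ≥ 0`. -/
def HasTimeFrequency (f : ℝ → ℝ) (μ : Measure ℝ) : Prop :=
  ∀ x : ℝ, Tendsto
    (fun T : ℝ => (1 / T) * ∫ t in (0 : ℝ)..T, (Set.Iic x).indicator (fun _ => (1 : ℝ)) (f t))
    atTop (𝓝 (cdf μ x))

/-- `μ` is the asymptotic frequency distribution of the sequence `u 1, u 2, …`. -/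
def HasSeqFrequency (u : ℤ → ℝ) (μ : Measure ℝ) : Prop :=
  ∀ x : ℝ, Tendsto
    (fun N : ℕ => (1 / (N : ℝ)) *
      ∑ n ∈ Finset.Icc 1 N, (Set.Iic x).indicator (fun _ => (1 : ℝ)) (u (n : ℤ)))
    atTop (𝓝 (cdf μ x))

end AoI

end

noncomputable section

namespace AoI

/-! The delays obey Lindley's recursion `D' = max (D - G) 0 + H` with i.i.d. pairs `(G, H)`.
Unrolled into the infinite past it yields a supremum of random-walk sums (`statDelay`), almost
surely finite because the drift `E[H] - E[G]` is negative; the law of this supremum is invariant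
under the recursion (`measurePreserving_delayStep`). Negative drift also empties the server, so two
delay paths with the same inputs coalesce whatever their initial values
(`IsTypical.exists_delayPath_eq`).

Coalescence drives the law of large numbers `ae_tendsto_avg_delayPath`. The event that the averages
of a bounded function of delay and next input exceed a level infinitely often does not depend on the
initial delay, hence is shift invariant up to a null set and has probability 0 or 1 by ergodicity of
the i.i.d. shift. The maximal ergodic inequality, applied to the stationary queue, rules out 1 when
the level lies above the stationary mean.

The peak age is `max D G + H`, so its frequencies follow at once. Between two departures the age
climbs at unit speed from the delay of the packet last departed to the next peak; it spends time
`min peak x - min D x` below `x`, and the mean length of such a cycle is `E[G]`. The quotient of the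
two means is the distribution function of the age. The antiderivative `-exp (-s y) / s` in place of
`min y x` gives the formula for the transform of `A`. The one for the peak comes from splitting `exp
(-s max D G)` by which of `D`, `G` is larger. For identically distributed variables, the frequencies
have constant mean, and bounded convergence identifies the law. -/

/-! ### The maximal ergodic inequality -/

/-- The maximum of `0` and of the first `n` Birkhoff sums of `g` along `T`. -/
def maxBirkhoff {X : Type*} (T : X → X) (g : X → ℝ) : ℕ → X → ℝ
  | 0, _ => 0
  | n + 1, x => max 0 (g x + maxBirkhoff T g n (T x))

section Maximal

variable {X : Type*} {T : X → X} {g : X → ℝ}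

lemma maxBirkhoff_nonneg (n : ℕ) (x : X) : 0 ≤ maxBirkhoff T g n x := by
  cases n with
  | zero => exact le_rfl
  | succ n => exact le_max_left _ _

lemma maxBirkhoff_le_succ (n : ℕ) : ∀ x, maxBirkhoff T g n x ≤ maxBirkhoff T g (n + 1) x := by
  induction n with
  | zero => exact fun x => maxBirkhoff_nonneg _ _
  | succ n ih =>
    intro x
    exact max_le_max le_rfl (add_le_add le_rfl (ih (T x)))

lemma birkhoffSum_le_maxBirkhoff (n : ℕ) : ∀ x, birkhoffSum T g n x ≤ maxBirkhoff T g n x := by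
  induction n with
  | zero => intro x; simp [maxBirkhoff]
  | succ n ih =>
    intro x
    rw [birkhoffSum_succ']
    exact le_max_of_le_right (add_le_add le_rfl (ih (T x)))

variable [MeasurableSpace X] {ν : Measure X}

lemma measurable_maxBirkhoff (hT : Measurable T) (hg : Measurable g) (n : ℕ) :
    Measurable (maxBirkhoff T g n) := by
  induction n with
  | zero => exact measurable_const
  | succ n ih => exact measurable_const.max (hg.add (ih.comp hT))

lemma integrable_maxBirkhoff (hT : MeasurePreserving T ν ν) (hg : Integrable g ν) (n : ℕ) :
    Integrable (maxBirkhoff T g n) ν := by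
  induction n with
  | zero => exact integrable_zero _ _ _
  | succ n ih =>
    exact (integrable_zero _ _ _).sup (hg.add (hT.integrable_comp_of_integrable ih))

/-- If almost surely some Birkhoff sum of `g` is positive, then `g` has non-negative integral. -/
theorem integral_nonneg_of_exists_birkhoffSum_pos (hT : MeasurePreserving T ν ν)
    (hgm : Measurable g) (hg : Integrable g ν)
    (hpos : ∀ᵐ x ∂ν, ∃ n, 0 < birkhoffSum T g n x) : 0 ≤ ∫ x, g x ∂ν := by
  set A : ℕ → Set X := fun n => {x | 0 < maxBirkhoff T g n x} with hA
  have hAm : ∀ n, MeasurableSet (A n) := fun n =>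
    measurableSet_lt measurable_const (measurable_maxBirkhoff hT.measurable hgm n)
  have hmono : ∀ x, Monotone fun n => maxBirkhoff T g n x := fun x =>
    monotone_nat_of_le_succ fun n => maxBirkhoff_le_succ n x
  have h1 : ∀ n, 0 ≤ ∫ x, (A n).indicator g x ∂ν := by
    intro n
    have hM := integrable_maxBirkhoff hT hg n
    have hMT : Integrable (fun x => maxBirkhoff T g n (T x)) ν :=
      hT.integrable_comp_of_integrable hM
    have h0 : ∫ x, (maxBirkhoff T g n x - maxBirkhoff T g n (T x)) ∂ν = 0 := by
      rw [integral_sub hM hMT, sub_eq_zero]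
      have := integral_map (μ := ν) hT.measurable.aemeasurable
        (f := maxBirkhoff T g n) (by rw [hT.map_eq]; exact hM.aestronglyMeasurable)
      rw [hT.map_eq] at this
      exact this
    rw [← h0]
    -- Garsia's argument: where the maximum is positive it is `g x` plus a shorter maximum at `T x`,
    -- hence at most `g x + maxBirkhoff T g n (T x)`; elsewhere it is zero and the difference is
    -- nonpositive.
    refine integral_mono (hM.sub hMT) (hg.indicator (hAm n)) fun x => ?_
    by_cases hx : x ∈ A n
    · simp only [Set.indicator_of_mem hx]
      cases n with
      | zero => exact absurd (show (0 : ℝ) < 0 from hx) (lt_irrefl _)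
      | succ n =>
        have hx' : 0 < max 0 (g x + maxBirkhoff T g n (T x)) := hx
        have h2 : maxBirkhoff T g (n + 1) x = g x + maxBirkhoff T g n (T x) := by
          rcases lt_max_iff.1 hx' with h | h
          · exact absurd h (lt_irrefl _)
          · exact max_eq_right h.le
        have := maxBirkhoff_le_succ (T := T) (g := g) n (T x)
        linarith
    · simp only [Set.indicator_of_notMem hx]
      have h2 : maxBirkhoff T g n x ≤ 0 := not_lt.1 hx
      have := maxBirkhoff_nonneg (T := T) (g := g) n (T x)
      linarith
  -- The sets `A n` increase to a set of full measure, so the integrals over them tend to the whole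
  -- integral.
  refine ge_of_tendsto' (tendsto_integral_of_dominated_convergence (fun x => ‖g x‖)
    (fun n => (hg.indicator (hAm n)).aestronglyMeasurable) hg.norm
    (fun n => Eventually.of_forall fun x => norm_indicator_le_norm_self _ _) ?_) h1
  filter_upwards [hpos] with x ⟨n, hn⟩
  refine tendsto_const_nhds.congr' ?_
  filter_upwards [eventually_ge_atTop n] with m hm
  have : x ∈ A m := lt_of_lt_of_le hn ((birkhoffSum_le_maxBirkhoff n x).trans (hmono x hm))
  exact (Set.indicator_of_mem this g).symm

end Maximal

/-! ### Cesàro averages of real sequences -/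

/-- The averages of `u` exceed some level above `c` infinitely often. -/
def AvgExceeds (u : ℕ → ℝ) (c : ℝ) : Prop :=
  ∃ j : ℕ, ∃ᶠ n : ℕ in atTop, c + 1 / ((j : ℝ) + 1) < (∑ k ∈ Finset.range n, u k) / n

/-- The margin `1 / (j + 1)` in `AvgExceeds` gives room: after division by `n` a bounded change of
the sums drops below the gap between `1 / (j + 1)` and a smaller margin `1 / (i + 1)`. -/
lemma AvgExceeds.of_abs_sum_sub_le {u v : ℕ → ℝ} {c K : ℝ}
    (h : ∀ n, |∑ k ∈ Finset.range n, u k - ∑ k ∈ Finset.range n, v k| ≤ K)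
    (hu : AvgExceeds u c) : AvgExceeds v c := by
  obtain ⟨j, hj⟩ := hu
  obtain ⟨i, hi⟩ := exists_nat_one_div_lt (show (0 : ℝ) < 1 / ((j : ℝ) + 1) by positivity)
  refine ⟨i, ?_⟩
  have hK : Tendsto (fun n : ℕ => K / n) atTop (𝓝 0) := tendsto_const_div_atTop_nhds_zero_nat K
  have hev := hK.eventually (gt_mem_nhds (sub_pos.2 hi))
  refine (hj.and_eventually (hev.and (eventually_gt_atTop 0))).mono ?_
  rintro n ⟨h1, h2, h3⟩
  have hn : (0 : ℝ) < n := by exact_mod_cast h3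
  have h4 : (∑ k ∈ Finset.range n, u k) / n - (∑ k ∈ Finset.range n, v k) / n ≤ K / n := by
    rw [← sub_div]
    exact div_le_div_of_nonneg_right ((le_abs_self _).trans (h n)) hn.le
  linarith

lemma avgExceeds_congr {u v : ℕ → ℝ} {c K : ℝ}
    (h : ∀ n, |∑ k ∈ Finset.range n, u k - ∑ k ∈ Finset.range n, v k| ≤ K) :
    AvgExceeds u c ↔ AvgExceeds v c :=
  ⟨AvgExceeds.of_abs_sum_sub_le h,
    AvgExceeds.of_abs_sum_sub_le fun n => by rw [abs_sub_comm]; exact h n⟩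

lemma abs_sum_sub_sum_succ_le {u : ℕ → ℝ} {C : ℝ} (hu : ∀ n, |u n| ≤ C) (n : ℕ) :
    |∑ k ∈ Finset.range n, u k - ∑ k ∈ Finset.range n, u (k + 1)| ≤ 2 * C := by
  rw [← Finset.sum_sub_distrib, Finset.sum_range_sub']
  have h1 := abs_le.1 (hu 0)
  have h2 := abs_le.1 (hu n)
  exact abs_le.2 ⟨by linarith, by linarith⟩

lemma abs_sum_sub_sum_le_of_eventuallyEq {u v : ℕ → ℝ} {N : ℕ} (h : ∀ n, N ≤ n → u n = v n)
    (n : ℕ) : |∑ k ∈ Finset.range n, u k - ∑ k ∈ Finset.range n, v k|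
      ≤ ∑ k ∈ Finset.range N, |u k - v k| := by
  rw [← Finset.sum_sub_distrib]
  refine (Finset.abs_sum_le_sum_abs _ _).trans ?_
  calc ∑ k ∈ Finset.range n, |u k - v k|
      ≤ ∑ k ∈ Finset.range (max n N), |u k - v k| :=
        Finset.sum_le_sum_of_subset_of_nonneg (Finset.range_mono (le_max_left _ _))
          fun _ _ _ => abs_nonneg _
    _ = ∑ k ∈ Finset.range N, |u k - v k| := by
        symm
        refine Finset.sum_subset (Finset.range_mono (le_max_right _ _)) fun k _ hk => ?_
        rw [h k (not_lt.1 fun hlt => hk (Finset.mem_range.2 hlt)), sub_self, abs_zero]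

lemma avgExceeds_congr_of_eventuallyEq {u v : ℕ → ℝ} {N : ℕ} {c : ℝ}
    (h : ∀ n, N ≤ n → u n = v n) : AvgExceeds u c ↔ AvgExceeds v c :=
  avgExceeds_congr (abs_sum_sub_sum_le_of_eventuallyEq h)

/-- The first hypothesis bounds the limsup by `L`, the second, for `-u`, bounds the liminf. -/
lemma tendsto_avg_of_not_avgExceeds {u : ℕ → ℝ} {L : ℝ}
    (h : ∀ j : ℕ, ¬ AvgExceeds u (L + 1 / ((j : ℝ) + 1)))
    (h' : ∀ j : ℕ, ¬ AvgExceeds (fun n => -u n) (-L + 1 / ((j : ℝ) + 1))) :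
    Tendsto (fun n : ℕ => (∑ k ∈ Finset.range n, u k) / n) atTop (𝓝 L) := by
  have key : ∀ (v : ℕ → ℝ) (M : ℝ), (∀ j : ℕ, ¬ AvgExceeds v (M + 1 / ((j : ℝ) + 1))) →
      ∀ a, M < a → ∀ᶠ n : ℕ in atTop, (∑ k ∈ Finset.range n, v k) / n < a := by
    intro v M hv a ha
    obtain ⟨j, hj⟩ := exists_nat_one_div_lt (half_pos (sub_pos.2 ha))
    have h1 := hv j
    simp only [AvgExceeds, not_exists, not_frequently, not_lt] at h1
    filter_upwards [h1 (j + 1)] with n hn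
    have : 1 / (((j + 1 : ℕ) : ℝ) + 1) ≤ 1 / ((j : ℝ) + 1) := by
      apply one_div_le_one_div_of_le (by positivity); push_cast; linarith
    linarith
  rw [tendsto_order]
  refine ⟨fun a ha => ?_, fun a ha => key u L h a ha⟩
  filter_upwards [key _ _ h' (-a) (neg_lt_neg ha)] with n hn
  rw [Finset.sum_neg_distrib, neg_div] at hn
  linarith

lemma tendsto_avg_congr {u v : ℕ → ℝ} {L K : ℝ}
    (h : ∀ n, |∑ k ∈ Finset.range n, u k - ∑ k ∈ Finset.range n, v k| ≤ K)
    (hu : Tendsto (fun n : ℕ => (∑ k ∈ Finset.range n, u k) / n) atTop (𝓝 L)) :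
    Tendsto (fun n : ℕ => (∑ k ∈ Finset.range n, v k) / n) atTop (𝓝 L) := by
  have hd : Tendsto (fun n : ℕ => (∑ k ∈ Finset.range n, u k) / n -
      (∑ k ∈ Finset.range n, v k) / n) atTop (𝓝 0) := by
    refine squeeze_zero_norm (fun n => ?_) (tendsto_const_div_atTop_nhds_zero_nat K)
    rw [← sub_div, norm_div, Real.norm_eq_abs, RCLike.norm_natCast]
    exact div_le_div_of_nonneg_right (h n) (Nat.cast_nonneg n)
  simpa using hu.sub hd

/-! ### Birkhoff averages of a bounded function -/

/-- If the averages exceeded `c` almost surely, some Birkhoff sum of `f - c` would be positive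
almost surely, and the maximal inequality would force `c ≤ ∫ f`. -/
theorem ae_not_avgExceeds {X : Type*} [MeasurableSpace X] {ν : Measure X}
    [IsProbabilityMeasure ν] {T : X → X} (hT : MeasurePreserving T ν ν) {f : X → ℝ}
    (hfm : Measurable f) (hf : Integrable f ν) {c : ℝ} (hc : ∫ x, f x ∂ν < c)
    (h01 : (∀ᵐ x ∂ν, AvgExceeds (fun k => f (T^[k] x)) c) ∨
      ∀ᵐ x ∂ν, ¬ AvgExceeds (fun k => f (T^[k] x)) c) :
    ∀ᵐ x ∂ν, ¬ AvgExceeds (fun k => f (T^[k] x)) c := by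
  refine h01.resolve_left fun h => ?_
  have hg : Integrable (fun x => f x - c) ν := hf.sub (integrable_const c)
  have := integral_nonneg_of_exists_birkhoffSum_pos hT (hfm.sub_const c) hg ?_
  · rw [integral_sub hf (integrable_const c)] at this
    simp at this
    linarith
  · filter_upwards [h] with x ⟨j, hj⟩
    obtain ⟨n, hn, hn0⟩ := (hj.and_eventually (eventually_gt_atTop 0)).exists
    refine ⟨n, ?_⟩
    have hnpos : (0 : ℝ) < n := by exact_mod_cast hn0
    have h1 : c < (∑ k ∈ Finset.range n, f (T^[k] x)) / n :=
      lt_trans (lt_add_of_pos_right _ (by positivity)) hn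
    rw [lt_div_iff₀ hnpos] at h1
    simp only [birkhoffSum, Finset.sum_sub_distrib, Finset.sum_const, Finset.card_range,
      nsmul_eq_mul]
    linarith [mul_comm c (n : ℝ)]

/-! ### The shift on sequences of independent, identically distributed variables -/

/-- The left shift of a sequence. -/
def shift {E : Type*} (z : ℕ → E) : ℕ → E := fun n => z (n + 1)

lemma shift_iterate_apply {E : Type*} (m n : ℕ) (z : ℕ → E) : shift^[m] z n = z (n + m) := by
  induction m generalizing z with
  | zero => rfl
  | succ m ih =>
    rw [Function.iterate_succ_apply, ih]
    exact congrArg z (by omega)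

section Shift

variable {E : Type*} [MeasurableSpace E] (μ : Measure E) [IsProbabilityMeasure μ]

/-- The law of a sequence of independent variables with law `μ`. -/
abbrev seqLaw : Measure (ℕ → E) := Measure.infinitePi fun _ : ℕ => μ

@[fun_prop]
lemma measurable_shift : Measurable (shift : (ℕ → E) → ℕ → E) :=
  measurable_pi_lambda _ fun n => measurable_pi_apply (n + 1)

/-- The shifted sequence is a function of the coordinates from 1 on, hence independent of coordinate
0, and has the same product law. -/
lemma measurePreserving_head_shift :
    MeasurePreserving (fun z : ℕ → E => (z 0, shift z)) (seqLaw μ) (μ.prod (seqLaw μ)) := by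
  have hindep : iIndepFun (fun (n : ℕ) (z : ℕ → E) => z n) (seqLaw μ) :=
    iIndepFun_infinitePi (X := fun _ => id) fun _ => measurable_id
  have hshift : (seqLaw μ).map shift = seqLaw μ :=
    Measure.map_infinitePi_infinitePi_of_inj (P := fun _ : ℕ => μ) (f := fun n : ℕ => n + 1)
      (add_left_injective 1)
  have hI : IndepFun (fun z : ℕ → E => z 0) shift (seqLaw μ) := by
    have := indep_iSup_of_disjoint (m := fun n : ℕ => MeasurableSpace.comap
      (fun z : ℕ → E => z n) inferInstance) (fun n => (measurable_pi_apply n).comap_le)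
      hindep (S := {0}) (T := {n | 1 ≤ n})
      (by rw [Set.disjoint_singleton_left]; simp)
    rw [IndepFun_iff_Indep]
    refine indep_of_indep_of_le_left (indep_of_indep_of_le_right this ?_) ?_
    · rw [← measurable_iff_comap_le]
      refine @measurable_pi_lambda _ _ _ (_) _ _ fun n => ?_
      rw [measurable_iff_comap_le]
      exact le_biSup (fun n : ℕ => MeasurableSpace.comap (fun z : ℕ → E => z n) inferInstance)
        (show n + 1 ∈ {n : ℕ | 1 ≤ n} by simp)
    · exact le_biSup (fun n : ℕ => MeasurableSpace.comap (fun z : ℕ → E => z n) inferInstance)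
        (Set.mem_singleton 0)
  refine ⟨by fun_prop, ?_⟩
  rw [(indepFun_iff_map_prod_eq_prod_map_map (measurable_pi_apply 0).aemeasurable
    measurable_shift.aemeasurable).1 hI, hshift,
    Measure.infinitePi_map_eval]

lemma measurePreserving_shift : MeasurePreserving (shift : (ℕ → E) → ℕ → E) (seqLaw μ) (seqLaw μ) :=
  measurePreserving_snd.comp (measurePreserving_head_shift μ)

/-- A strictly invariant set is its own preimage under every `shift^[m]`, so it is a tail event and
Kolmogorov's zero-one law applies. -/
theorem ergodic_shift : Ergodic (shift : (ℕ → E) → ℕ → E) (seqLaw μ) := by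
  refine ⟨measurePreserving_shift μ, ⟨fun s hs hinv => ?_⟩⟩
  have hindep : iIndepFun (fun (n : ℕ) (z : ℕ → E) => z n) (seqLaw μ) :=
    iIndepFun_infinitePi (X := fun _ => id) fun _ => measurable_id
  have htail : MeasurableSet[limsup (fun n : ℕ => MeasurableSpace.comap
      (fun z : ℕ → E => z n) inferInstance) atTop] s := by
    rw [limsup_eq_iInf_iSup_of_nat, MeasurableSpace.measurableSet_iInf]
    intro m
    have hm : shift^[m] ⁻¹' s = s := Function.IsFixedPt.preimage_iterate hinv m
    rw [← hm]
    refine (@measurable_pi_lambda _ _ _ (_) _ (fun z => shift^[m] z) fun n => ?_) hs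
    simp only [shift_iterate_apply]
    rw [measurable_iff_comap_le]
    exact le_biSup (fun n : ℕ => MeasurableSpace.comap (fun z : ℕ → E => z n) inferInstance)
      (show n + m ≥ m by omega)
  have := measure_zero_or_one_of_measurableSet_limsup_atTop
    (fun n => (measurable_pi_apply n).comap_le) hindep htail
  rw [eventuallyConst_set']
  rcases this with h | h
  · exact Or.inl (ae_eq_empty.2 h)
  · exact Or.inr (ae_eq_univ.2 ((prob_compl_eq_zero_iff hs).2 h))

end Shift

/-! ### The delay recursion -/

/-- The delay of a packet with (interarrival time, service time) `p` that follows a packet with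
delay `d`. -/
def delayStep (d : ℝ) (p : ℝ × ℝ) : ℝ := max (d - p.1) 0 + p.2

/-- The successive delays, started at `d` and driven by the inputs `z`. -/
def delayPath (d : ℝ) (z : ℕ → ℝ × ℝ) : ℕ → ℝ
  | 0 => d
  | n + 1 => delayStep (delayPath d z n) (z n)

@[fun_prop]
lemma measurable_delayStep : Measurable fun q : ℝ × (ℝ × ℝ) => delayStep q.1 q.2 := by
  unfold delayStep; fun_prop

lemma measurable_delayPath (n : ℕ) :
    Measurable fun q : ℝ × (ℕ → ℝ × ℝ) => delayPath q.1 q.2 n := by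
  induction n with
  | zero => exact measurable_fst
  | succ n ih =>
    exact measurable_delayStep.comp
      (ih.prodMk ((measurable_pi_apply n).comp measurable_snd))

lemma delayStep_mono {d d' : ℝ} (h : d ≤ d') (p : ℝ × ℝ) : delayStep d p ≤ delayStep d' p :=
  add_le_add (max_le_max (sub_le_sub_right h _) le_rfl) le_rfl

lemma delayPath_mono {d d' : ℝ} (h : d ≤ d') (z : ℕ → ℝ × ℝ) (n : ℕ) :
    delayPath d z n ≤ delayPath d' z n := by
  induction n with
  | zero => exact h
  | succ n ih => exact delayStep_mono ih _

lemma delayPath_shift (d : ℝ) (z : ℕ → ℝ × ℝ) (n : ℕ) :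
    delayPath (delayStep d (z 0)) (shift z) n = delayPath d z (n + 1) := by
  induction n with
  | zero => rfl
  | succ n ih => rw [delayPath, ih]; rfl

/-- Inputs that are non-negative and whose averages converge. -/
structure IsTypical (g h : ℝ) (z : ℕ → ℝ × ℝ) : Prop where
  nonneg : ∀ n, 0 ≤ (z n).1 ∧ 0 ≤ (z n).2
  tendsto_fst : Tendsto (fun n : ℕ => (∑ k ∈ Finset.range n, (z k).1) / n) atTop (𝓝 g)
  tendsto_snd : Tendsto (fun n : ℕ => (∑ k ∈ Finset.range n, (z k).2) / n) atTop (𝓝 h)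

section Typical

variable {g h : ℝ} {z : ℕ → ℝ × ℝ}

lemma IsTypical.tendsto_sum_sub (hz : IsTypical g h z) :
    Tendsto (fun n : ℕ => (∑ k ∈ Finset.range n, ((z k).2 - (z k).1)) / n) atTop
      (𝓝 (h - g)) := by
  refine (hz.tendsto_snd.sub hz.tendsto_fst).congr fun n => ?_
  rw [Finset.sum_sub_distrib, sub_div]

lemma tendsto_atBot_of_div_nat {u : ℕ → ℝ} {c : ℝ} (hc : c < 0)
    (hu : Tendsto (fun n : ℕ => u n / n) atTop (𝓝 c)) : Tendsto u atTop atBot := by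
  refine (hu.neg_mul_atTop hc tendsto_natCast_atTop_atTop).congr' ?_
  filter_upwards [eventually_gt_atTop 0] with n hn
  have : (n : ℝ) ≠ 0 := by positivity
  field_simp

lemma IsTypical.delayPath_nonneg (hz : IsTypical g h z) {d : ℝ} (hd : 0 ≤ d) (n : ℕ) :
    0 ≤ delayPath d z n := by
  cases n with
  | zero => exact hd
  | succ n => exact add_nonneg (le_max_right _ _) (hz.nonneg n).2

/-- The server empties. -/
lemma IsTypical.exists_delayPath_le (hz : IsTypical g h z) (hgh : h < g) (d : ℝ) :
    ∃ n, delayPath d z n ≤ (z n).1 := by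
  -- If the server never empties, the truncation at 0 never acts and the delay is a random walk with
  -- negative drift, which must become negative.
  by_contra! hcon
  have hpath : ∀ n, delayPath d z n = d + ∑ k ∈ Finset.range n, ((z k).2 - (z k).1) := by
    intro n
    induction n with
    | zero => simp [delayPath]
    | succ n ih =>
      rw [Finset.sum_range_succ, delayPath, delayStep, max_eq_left (sub_nonneg.2 (hcon n).le), ih]
      ring
  have hbot := tendsto_atBot_of_div_nat (sub_neg.2 hgh) hz.tendsto_sum_sub
  obtain ⟨n, hn⟩ := (hbot.eventually (eventually_lt_atBot (-d))).exists
  have h1 := hcon n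
  have h2 := (hz.nonneg n).1
  rw [hpath] at h1
  linarith

/-- Delays started from different values coincide eventually. -/
lemma IsTypical.exists_delayPath_eq (hz : IsTypical g h z) (hgh : h < g) (d d' : ℝ) :
    ∃ N, ∀ n, N ≤ n → delayPath d z n = delayPath d' z n := by
  -- When the server empties for the larger initial delay it does so for the smaller one too, by
  -- monotonicity; the next delay is then the bare service time in both.
  obtain ⟨m, hm⟩ := hz.exists_delayPath_le hgh (max d d')
  have key : ∀ e, e ≤ max d d' → delayPath e z (m + 1) = (z m).2 := by
    intro e he
    have := (delayPath_mono he z m).trans hm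
    rw [delayPath, delayStep, max_eq_right (sub_nonpos.2 this), zero_add]
  refine ⟨m + 1, fun n hn => ?_⟩
  induction n, hn using Nat.le_induction with
  | base => rw [key _ (le_max_left _ _), key _ (le_max_right _ _)]
  | succ n _ ih => rw [delayPath, delayPath, ih]

/-- A single term is the difference of two successive partial sums. -/
lemma tendsto_term_div_of_tendsto_avg {u : ℕ → ℝ} {L : ℝ}
    (hu : Tendsto (fun n : ℕ => (∑ k ∈ Finset.range n, u k) / n) atTop (𝓝 L)) :
    Tendsto (fun n : ℕ => u n / n) atTop (𝓝 0) := by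
  have h1 : Tendsto (fun n : ℕ => 1 + 1 / (n : ℝ)) atTop (𝓝 (1 + 0)) :=
    tendsto_const_nhds.add tendsto_one_div_atTop_nhds_zero_nat
  have h2 := ((hu.comp (tendsto_add_atTop_nat 1)).mul h1).sub hu
  rw [add_zero, mul_one, sub_self] at h2
  refine h2.congr' ?_
  filter_upwards [eventually_gt_atTop 0] with n hn
  have : (n : ℝ) ≠ 0 := by positivity
  have h3 : ((n : ℝ) + 1) ≠ 0 := by positivity
  simp only [Function.comp_apply, Finset.sum_range_succ]
  push_cast
  field_simp
  ring

/-- Delays are sublinear. -/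
lemma IsTypical.tendsto_delayPath_div (hz : IsTypical g h z) (hgh : h < g) {d : ℝ} (hd : 0 ≤ d) :
    Tendsto (fun n : ℕ => delayPath d z n / n) atTop (𝓝 0) := by
  set S : ℕ → ℝ := fun n => ∑ k ∈ Finset.range n, ((z k).2 - (z k).1) with hS
  have hSlim : Tendsto (fun n : ℕ => S n / n) atTop (𝓝 (h - g)) := hz.tendsto_sum_sub
  have hglim := tendsto_term_div_of_tendsto_avg hz.tendsto_fst
  -- Relative to the walk `S`, the delay is a running maximum of `d` and the values `(z k).1 - S k`,
  -- so only their growth matters.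
  have hrec : ∀ n, delayPath d z (n + 1) - S (n + 1)
      = max (delayPath d z n - S n) ((z n).1 - S n) := by
    intro n
    rw [max_sub_sub_right, hS]
    simp only [Finset.sum_range_succ, delayPath, delayStep]
    have : max (delayPath d z n - (z n).1) 0 = max (delayPath d z n) (z n).1 - (z n).1 := by
      rw [← max_sub_sub_right, sub_self]
    rw [this]
    ring
  rw [tendsto_order]
  refine ⟨fun a ha => Eventually.of_forall fun n => ha.trans_le
    (div_nonneg (hz.delayPath_nonneg hd n) (Nat.cast_nonneg n)), fun ε hε => ?_⟩
  -- `(z n).1 - S n` grows at rate `g - h`, hence stays below `l * n` up to a constant; adding back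
  -- `S n / n → h - g` leaves `ε / 2 < ε`.
  set l : ℝ := g - h + ε / 2 with hl
  have hbot : Tendsto (fun n : ℕ => ((z n).1 - S n) - l * n) atTop atBot := by
    refine tendsto_atBot_of_div_nat (c := 0 - (h - g) - l) (by rw [hl]; linarith) ?_
    refine ((hglim.sub hSlim).sub_const l).congr' ?_
    filter_upwards [eventually_gt_atTop 0] with n hn
    have : (n : ℝ) ≠ 0 := by positivity
    field_simp
  obtain ⟨C, hC⟩ := bddAbove_range_of_tendsto_atTop_atBot hbot
  have hbound : ∀ n : ℕ, delayPath d z n - S n ≤ max C d + l * n := by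
    intro n
    induction n with
    | zero => simp [hS, delayPath]
    | succ n ih =>
      have h1 : (z n).1 - S n - l * n ≤ C := hC ⟨n, rfl⟩
      have h2 := le_max_left C d
      rw [hrec]
      push_cast
      have hlpos : 0 < l := by rw [hl]; linarith
      exact max_le (by linarith) (by linarith)
  have hlim : Tendsto (fun n : ℕ => max C d / n + l + S n / n) atTop (𝓝 (0 + l + (h - g))) :=
    ((tendsto_const_div_atTop_nhds_zero_nat _).add_const l).add hSlim
  filter_upwards [hlim.eventually (gt_mem_nhds (show 0 + l + (h - g) < ε by rw [hl]; linarith)),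
    eventually_gt_atTop 0] with n hn hn0
  refine lt_of_le_of_lt ?_ hn
  have hnpos : (0 : ℝ) < n := by exact_mod_cast hn0
  rw [div_le_iff₀ hnpos, add_mul, add_mul, div_mul_cancel₀ _ hnpos.ne',
    div_mul_cancel₀ _ hnpos.ne']
  linarith [hbound n]

lemma IsTypical.isTypical_shift (hz : IsTypical g h z) : IsTypical g h (shift z) := by
  have key : ∀ (u : ℕ → ℝ) (L : ℝ),
      Tendsto (fun n : ℕ => (∑ k ∈ Finset.range n, u k) / n) atTop (𝓝 L) →
      Tendsto (fun n : ℕ => (∑ k ∈ Finset.range n, u (k + 1)) / n) atTop (𝓝 L) := by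
    intro u L hu
    have h2 := (hu.add (tendsto_term_div_of_tendsto_avg hu)).sub
      (tendsto_const_div_atTop_nhds_zero_nat (u 0))
    rw [add_zero, sub_zero] at h2
    refine h2.congr fun n => ?_
    rw [← add_div, ← sub_div, ← Finset.sum_range_succ, Finset.sum_range_succ', add_sub_cancel_right]
  exact ⟨fun n => hz.nonneg (n + 1), key (fun n => (z n).1) g hz.tendsto_fst,
    key (fun n => (z n).2) h hz.tendsto_snd⟩

/-! ### The stationary delay -/

/-- The partial sums whose supremum is the stationary delay. -/
def delaySum (z : ℕ → ℝ × ℝ) (n : ℕ) : ℝ :=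
  (z n).2 + ∑ k ∈ Finset.range n, ((z k).2 - (z k).1)

/-- The delay in a system that has been running forever, where `z` lists the inputs backwards in
time. -/
def statDelay (z : ℕ → ℝ × ℝ) : ℝ := ⨆ n, delaySum z n

lemma measurable_statDelay : Measurable statDelay := by
  refine Measurable.iSup fun n => ?_
  unfold delaySum
  fun_prop

lemma delaySum_succ (z : ℕ → ℝ × ℝ) (n : ℕ) :
    delaySum z (n + 1) = delaySum (shift z) n - (z 0).1 + (z 0).2 := by
  simp only [delaySum, Finset.sum_range_succ', shift]
  ring

lemma IsTypical.bddAbove_delaySum (hz : IsTypical g h z) (hgh : h < g) :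
    BddAbove (Set.range (delaySum z)) := by
  refine bddAbove_range_of_tendsto_atTop_atBot (tendsto_atBot_of_div_nat (c := 0 + (h - g))
    (by linarith) ?_)
  refine ((tendsto_term_div_of_tendsto_avg hz.tendsto_snd).add hz.tendsto_sum_sub).congr
    fun n => ?_
  rw [← add_div, delaySum]

lemma IsTypical.statDelay_nonneg (hz : IsTypical g h z) (hgh : h < g) : 0 ≤ statDelay z :=
  (show 0 ≤ delaySum z 0 by simpa [delaySum] using (hz.nonneg 0).2).trans
    (le_ciSup (hz.bddAbove_delaySum hgh) 0)

/-- Index 0 is the latest packet. Term 0 of the supremum is the case of an idle server; the terms `n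
+ 1` are those of the preceding packet, moved by `(z 0).2 - (z 0).1`. Their joint supremum is
Lindley's recursion. -/
lemma IsTypical.statDelay_eq (hz : IsTypical g h z) (hgh : h < g) :
    statDelay z = delayStep (statDelay (shift z)) (z 0) := by
  have hb := hz.bddAbove_delaySum hgh
  have hb' := hz.isTypical_shift.bddAbove_delaySum hgh
  apply le_antisymm
  · refine ciSup_le fun n => ?_
    cases n with
    | zero => simp [delaySum, delayStep]
    | succ n =>
      rw [delaySum_succ]
      exact add_le_add (le_max_of_le_left (sub_le_sub_right (le_ciSup hb' n) _)) le_rfl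
  · rw [delayStep, ← le_sub_iff_add_le, max_le_iff]
    constructor
    · rw [sub_le_iff_le_add]
      refine ciSup_le fun n => ?_
      have := le_ciSup hb (n + 1)
      rw [delaySum_succ] at this
      unfold statDelay
      linarith
    · have := le_ciSup hb 0
      simp only [delaySum, Finset.range_zero, Finset.sum_empty, add_zero] at this
      exact sub_nonneg.2 this

end Typical

/-! ### Stationary law of the delay and law of large numbers for the queue. -/

section Law

variable {μ : Measure (ℝ × ℝ)} [IsProbabilityMeasure μ]

lemma ae_isTypical (h0 : ∀ᵐ p ∂μ, 0 ≤ p.1 ∧ 0 ≤ p.2) (h1 : Integrable (fun p => p.1) μ)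
    (h2 : Integrable (fun p => p.2) μ) :
    ∀ᵐ z ∂seqLaw μ, IsTypical (∫ p, p.1 ∂μ) (∫ p, p.2 ∂μ) z := by
  have hev : ∀ n : ℕ, MeasurePreserving (fun z : ℕ → ℝ × ℝ => z n) (seqLaw μ) μ :=
    fun n => measurePreserving_eval_infinitePi (fun _ : ℕ => μ) n
  have slln : ∀ f : ℝ × ℝ → ℝ, Measurable f → Integrable f μ → ∀ᵐ z ∂seqLaw μ,
      Tendsto (fun n : ℕ => (∑ k ∈ Finset.range n, f (z k)) / n) atTop (𝓝 (∫ p, f p ∂μ)) := by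
    intro f hfm hf
    have hind : iIndepFun (fun (n : ℕ) (z : ℕ → ℝ × ℝ) => f (z n)) (seqLaw μ) :=
      iIndepFun_infinitePi (X := fun _ => f) fun _ => hfm
    have hlaw : ∀ n : ℕ, (seqLaw μ).map (fun z => f (z n)) = μ.map f := fun n => by
      have := Measure.map_map (μ := seqLaw μ) hfm (hev n).measurable
      rw [(hev n).map_eq] at this
      exact this.symm
    have := strong_law_ae_real (μ := seqLaw μ) (fun n z => f (z n))
      ((hev 0).integrable_comp_of_integrable hf) (fun i j hij => hind.indepFun hij)
      fun i => ⟨(hfm.comp (hev i).measurable).aemeasurable,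
        (hfm.comp (hev 0).measurable).aemeasurable, by rw [hlaw, hlaw]⟩
    have hint : ∫ z, f (z 0) ∂seqLaw μ = ∫ p, f p ∂μ := by
      conv_rhs => rw [← (hev 0).map_eq]
      rw [integral_map (hev 0).measurable.aemeasurable hfm.aestronglyMeasurable]
    rwa [hint] at this
  have hnn : ∀ᵐ z ∂seqLaw μ, ∀ n, 0 ≤ (z n).1 ∧ 0 ≤ (z n).2 :=
    ae_all_iff.2 fun n => (hev n).quasiMeasurePreserving.ae h0
  filter_upwards [hnn, slln _ measurable_fst h1, slln _ measurable_snd h2] with z a b c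
  exact ⟨a, b, c⟩

/-- The law of the stationary delay. -/
def delayLaw (μ : Measure (ℝ × ℝ)) [IsProbabilityMeasure μ] : Measure ℝ :=
  (seqLaw μ).map statDelay

instance : IsProbabilityMeasure (delayLaw μ) :=
  Measure.isProbabilityMeasure_map measurable_statDelay.aemeasurable

/-- The state of the queue and its future inputs, seen from the next packet. -/
def queueShift (q : ℝ × (ℕ → ℝ × ℝ)) : ℝ × (ℕ → ℝ × ℝ) := (delayStep q.1 (q.2 0), shift q.2)

lemma queueShift_iterate (n : ℕ) (d : ℝ) (z : ℕ → ℝ × ℝ) :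
    queueShift^[n] (d, z) = (delayPath d z n, shift^[n] z) := by
  induction n with
  | zero => rfl
  | succ n ih =>
    rw [Function.iterate_succ_apply', ih, Function.iterate_succ_apply']
    simp only [queueShift, delayPath, shift_iterate_apply, zero_add]

variable (h0 : ∀ᵐ p ∂μ, 0 ≤ p.1 ∧ 0 ≤ p.2) (h1 : Integrable (fun p => p.1) μ)
  (h2 : Integrable (fun p => p.2) μ) (h12 : ∫ p, p.2 ∂μ < ∫ p, p.1 ∂μ)

include h0 h1 h2 h12

lemma ae_delayLaw_nonneg : ∀ᵐ d ∂delayLaw μ, 0 ≤ d := by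
  rw [delayLaw, ae_map_iff measurable_statDelay.aemeasurable measurableSet_Ici]
  filter_upwards [ae_isTypical h0 h1 h2] with z hz using hz.statDelay_nonneg h12

/-- `statDelay (shift z)` depends on the past only, so it is independent of `z 0`; one step of the
recursion turns this pair into `statDelay z`, which has the same law. -/
lemma measurePreserving_delayStep :
    MeasurePreserving (fun q : ℝ × (ℝ × ℝ) => delayStep q.1 q.2) ((delayLaw μ).prod μ)
      (delayLaw μ) := by
  have hD : MeasurePreserving statDelay (seqLaw μ) (delayLaw μ) := ⟨measurable_statDelay, rfl⟩
  have h3 : MeasurePreserving (fun z : ℕ → ℝ × ℝ => (statDelay (shift z), z 0)) (seqLaw μ)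
      ((delayLaw μ).prod μ) :=
    (Measure.measurePreserving_swap.comp ((MeasurePreserving.id μ).prod hD)).comp
      (measurePreserving_head_shift μ)
  refine ⟨measurable_delayStep, ?_⟩
  rw [← h3.map_eq, Measure.map_map measurable_delayStep h3.measurable, delayLaw]
  refine Measure.map_congr ?_
  filter_upwards [ae_isTypical h0 h1 h2] with z hz using (hz.statDelay_eq h12).symm

/-- The first future input is split off and absorbed into the delay; the remaining inputs are still
i.i.d. and independent of the new delay. -/
lemma measurePreserving_queueShift :
    MeasurePreserving queueShift ((delayLaw μ).prod (seqLaw μ))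
      ((delayLaw μ).prod (seqLaw μ)) := by
  have a := (MeasurePreserving.id (delayLaw μ)).prod (measurePreserving_head_shift μ)
  have b := (measurePreserving_prodAssoc (delayLaw μ) μ (seqLaw μ)).symm
  have c := (measurePreserving_delayStep h0 h1 h2 h12).prod (MeasurePreserving.id (seqLaw μ))
  exact c.comp (b.comp a)

/-- The delays together with the inputs obey the law of large numbers, whatever the first delay. -/
theorem ae_tendsto_avg_delayPath {φ : ℝ × (ℝ × ℝ) → ℝ} (hφ : Measurable φ) {C : ℝ}
    (hC : ∀ q, |φ q| ≤ C) :
    ∀ᵐ z ∂seqLaw μ, ∀ d, Tendsto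
      (fun n : ℕ => (∑ k ∈ Finset.range n, φ (delayPath d z k, z k)) / n) atTop
      (𝓝 (∫ q, φ q ∂((delayLaw μ).prod μ))) := by
  have htyp := ae_isTypical h0 h1 h2
  have hT := measurePreserving_queueShift h0 h1 h2 h12
  -- One-sided bound, used for `φ` and for `-φ`.
  have half : ∀ ψ : ℝ × (ℝ × ℝ) → ℝ, Measurable ψ → (∀ q, |ψ q| ≤ C) →
      ∀ c, ∫ q, ψ q ∂((delayLaw μ).prod μ) < c →
      ∀ᵐ z ∂seqLaw μ, ∀ d, ¬ AvgExceeds (fun k => ψ (delayPath d z k, z k)) c := by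
    intro ψ hψ hψC c hc
    have hcouple : ∀ z, IsTypical (∫ p, p.1 ∂μ) (∫ p, p.2 ∂μ) z → ∀ d d',
        AvgExceeds (fun k => ψ (delayPath d z k, z k)) c ↔
          AvgExceeds (fun k => ψ (delayPath d' z k, z k)) c := by
      intro z hz d d'
      obtain ⟨N, hN⟩ := hz.exists_delayPath_eq h12 d d'
      exact avgExceeds_congr_of_eventuallyEq (N := N) fun n hn => by rw [hN n hn]
    set A : Set (ℕ → ℝ × ℝ) := {z | AvgExceeds (fun k => ψ (delayPath 0 z k, z k)) c} with hA
    have hAm : MeasurableSet A := by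
      have hm : ∀ n : ℕ, Measurable fun z : ℕ → ℝ × ℝ =>
          (∑ k ∈ Finset.range n, ψ (delayPath 0 z k, z k)) / n := fun n =>
        (Finset.measurable_sum _ fun k _ => hψ.comp (((measurable_delayPath k).comp
          (measurable_const.prodMk measurable_id)).prodMk (measurable_pi_apply k))).div_const _
      have : A = ⋃ j : ℕ, limsup (fun n : ℕ => {z : ℕ → ℝ × ℝ | c + 1 / ((j : ℝ) + 1) <
          (∑ k ∈ Finset.range n, ψ (delayPath 0 z k, z k)) / n}) atTop := by
        ext z
        simp only [hA, AvgExceeds, Set.mem_iUnion, mem_limsup_iff_frequently_mem, Set.mem_ofPred_eq]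
      rw [this]
      exact MeasurableSet.iUnion fun j => MeasurableSet.measurableSet_limsup fun n =>
        measurableSet_lt measurable_const (hm n)
    -- Coalescence allows the shifted path to start at `delayStep 0 (z 0)` instead of 0; it is then
    -- the original path without its first term.
    have hAinv : shift ⁻¹' A =ᵐ[seqLaw μ] A := by
      filter_upwards [htyp] with z hz
      refine propext ?_
      change AvgExceeds (fun k => ψ (delayPath 0 (shift z) k, shift z k)) c ↔
        AvgExceeds (fun k => ψ (delayPath 0 z k, z k)) c
      rw [hcouple _ hz.isTypical_shift 0 (delayStep 0 (z 0))]
      simp only [delayPath_shift]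
      exact (avgExceeds_congr (abs_sum_sub_sum_succ_le
        (u := fun k => ψ (delayPath 0 z k, z k)) fun n => hψC _)).symm
    have hA01 := (ergodic_shift μ).quasiErgodic.ae_mem_or_ae_notMem₀ hAm.nullMeasurableSet hAinv
    set f : ℝ × (ℕ → ℝ × ℝ) → ℝ := fun q => ψ (q.1, q.2 0) with hf
    have hfm : Measurable f := hψ.comp
      (measurable_fst.prodMk ((measurable_pi_apply 0).comp measurable_snd))
    have hψf : ∫ q, f q ∂((delayLaw μ).prod (seqLaw μ)) = ∫ q, ψ q ∂((delayLaw μ).prod μ) := by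
      have hmp := (MeasurePreserving.id (delayLaw μ)).prod
        (measurePreserving_eval_infinitePi (fun _ : ℕ => μ) 0)
      rw [← hmp.map_eq, integral_map hmp.measurable.aemeasurable hψ.aestronglyMeasurable]
      rfl
    have hiter : ∀ d z k, f (queueShift^[k] (d, z)) = ψ (delayPath d z k, z k) := by
      intro d z k
      rw [queueShift_iterate, hf]
      simp only [shift_iterate_apply, zero_add]
    have hfint : Integrable f ((delayLaw μ).prod (seqLaw μ)) :=
      Integrable.of_bound hfm.aestronglyMeasurable C (Eventually.of_forall fun q => hψC _)
    have hsnd : Measure.QuasiMeasurePreserving (Prod.snd : ℝ × (ℕ → ℝ × ℝ) → _)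
        ((delayLaw μ).prod (seqLaw μ)) (seqLaw μ) := Measure.quasiMeasurePreserving_snd
    have hfin := ae_not_avgExceeds hT hfm hfint (c := c) (by rwa [hψf]) <| by
      refine hA01.imp (fun h => ?_) fun h => ?_
      · filter_upwards [hsnd.ae h, hsnd.ae htyp] with q hq hq'
        simp only [hiter q.1 q.2]
        exact (hcouple _ hq' _ _).1 hq
      · filter_upwards [hsnd.ae h, hsnd.ae htyp] with q hq hq'
        simp only [hiter q.1 q.2]
        exact fun h' => hq ((hcouple _ hq' _ _).1 h')
    -- Fubini gives one initial delay that works for almost all inputs; coalescence extends this to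
    -- every `d'` off a single null set.
    obtain ⟨d, hd⟩ := (Measure.ae_ae_of_ae_prod hfin).exists
    filter_upwards [hd, htyp] with z hz hz' d'
    simp only [hiter] at hz
    exact fun h' => hz ((hcouple _ hz' _ _).1 h')
  have hpos : ∀ j : ℕ, (0 : ℝ) < 1 / ((j : ℝ) + 1) := fun j => by positivity
  have A1 := fun j : ℕ => half φ hφ hC (∫ q, φ q ∂((delayLaw μ).prod μ) + 1 / ((j : ℝ) + 1))
    (lt_add_of_pos_right _ (hpos j))
  have A2 := fun j : ℕ => half (fun q => -φ q) hφ.neg (fun q => by rw [abs_neg]; exact hC q)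
    (-(∫ q, φ q ∂((delayLaw μ).prod μ)) + 1 / ((j : ℝ) + 1))
    (by rw [integral_neg]; exact lt_add_of_pos_right _ (hpos j))
  filter_upwards [ae_all_iff.2 A1, ae_all_iff.2 A2] with z hz1 hz2 d
  exact tendsto_avg_of_not_avgExceeds (fun j => hz1 j d) fun j => hz2 j d

end Law

/-! ### The stationary peak age and the stationary age -/

/-- Variables with the same law have the same mean as soon as their difference is integrable. -/
lemma integral_sub_eq_zero_of_map_eq {X : Type*} [MeasurableSpace X] {ν : Measure X}
    [IsProbabilityMeasure ν] {u v : X → ℝ} (hu : Measurable u) (hv : Measurable v)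
    (huv : ν.map u = ν.map v) (hint : Integrable (fun x => u x - v x) ν) :
    ∫ x, (u x - v x) ∂ν = 0 := by
  -- `u` and `v` need not be integrable themselves. Truncation to `[-n, n]` is 1-Lipschitz, so
  -- differences of truncations are dominated by `|u - v|`.
  set clip : ℕ → ℝ → ℝ := fun n t => max (min t n) (-n) with hclip
  have hcm : ∀ n, Measurable (clip n) := fun n =>
    (measurable_id.min measurable_const).max measurable_const
  have hcb : ∀ n t, |clip n t| ≤ n := fun n t =>
    abs_le.2 ⟨le_max_right _ _, max_le (min_le_right _ _)
      ((neg_nonpos.2 (Nat.cast_nonneg n)).trans (Nat.cast_nonneg n))⟩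
  have hci : ∀ (w : X → ℝ), Measurable w → ∀ n, Integrable (fun x => clip n (w x)) ν :=
    fun w hw n => Integrable.of_bound ((hcm n).comp hw).aestronglyMeasurable n
      (Eventually.of_forall fun x => hcb n (w x))
  have hzero : ∀ n, ∫ x, (clip n (u x) - clip n (v x)) ∂ν = 0 := by
    intro n
    rw [integral_sub (hci u hu n) (hci v hv n), sub_eq_zero]
    have h1 := integral_map (μ := ν) hu.aemeasurable (hcm n).aestronglyMeasurable
    have h2 := integral_map (μ := ν) hv.aemeasurable (hcm n).aestronglyMeasurable
    rw [← h1, ← h2, huv]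
  have hlim : ∀ t, ∀ᶠ n : ℕ in atTop, clip n t = t := by
    intro t
    obtain ⟨N, hN⟩ := exists_nat_ge |t|
    filter_upwards [eventually_ge_atTop N] with n hn
    have hn' : |t| ≤ n := hN.trans (by exact_mod_cast hn)
    have := abs_le.1 hn'
    simp only [hclip]
    rw [min_eq_left this.2, max_eq_left this.1]
  have := tendsto_integral_of_dominated_convergence (μ := ν)
    (F := fun n x => clip n (u x) - clip n (v x)) (f := fun x => u x - v x)
    (fun x => |u x - v x|)
    (fun n => ((hci u hu n).sub (hci v hv n)).aestronglyMeasurable) hint.abs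
    (fun n => Eventually.of_forall fun x => by
      simp only [hclip, Real.norm_eq_abs]
      refine (abs_max_sub_max_le_abs _ _ _).trans ((abs_min_sub_min_le_max _ _ _ _).trans ?_)
      simp)
    (Eventually.of_forall fun x => tendsto_const_nhds.congr' <| by
      filter_upwards [hlim (u x), hlim (v x)] with n h1 h2
      rw [h1, h2])
  simp only [hzero] at this
  exact (tendsto_nhds_unique this tendsto_const_nhds)

/-- The peak age at the departure of a packet with (interarrival time, service time) `q.2` that
follows a packet with delay `q.1`. -/
def peakOf (q : ℝ × (ℝ × ℝ)) : ℝ := max q.1 q.2.1 + q.2.2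

@[fun_prop]
lemma measurable_peakOf : Measurable peakOf := by
  unfold peakOf; fun_prop

section Law

variable (μ : Measure (ℝ × ℝ)) [IsProbabilityMeasure μ]

/-- The joint law of the stationary delay of a packet and of the next input. -/
abbrev stateLaw : Measure (ℝ × (ℝ × ℝ)) := (delayLaw μ).prod μ

/-- The law of the stationary peak age. -/
def peakLaw : Measure ℝ := (stateLaw μ).map peakOf

instance : IsProbabilityMeasure (peakLaw μ) :=
  Measure.isProbabilityMeasure_map measurable_peakOf.aemeasurable

/-- The pairs of a state and a value of the age between two successive departures. -/
def ageRegion : Set ((ℝ × (ℝ × ℝ)) × ℝ) := {r | r.1.1 ≤ r.2 ∧ r.2 < peakOf r.1}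

lemma measurableSet_ageRegion : MeasurableSet ageRegion :=
  (measurableSet_le (measurable_fst.comp measurable_fst) measurable_snd).inter
    (measurableSet_lt measurable_snd (measurable_peakOf.comp measurable_fst))

/-- The law of the stationary age: between successive departures the age runs through the interval
from the delay to the peak age. -/
def ageLaw : Measure ℝ :=
  ENNReal.ofReal (∫ p, p.1 ∂μ)⁻¹ •
    (((stateLaw μ).prod volume).restrict ageRegion).map Prod.snd

variable {μ}

lemma lintegral_ageLaw {f : ℝ → ENNReal} (hf : Measurable f) :
    ∫⁻ y, f y ∂ageLaw μ = ENNReal.ofReal (∫ p, p.1 ∂μ)⁻¹ *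
      ∫⁻ q, (∫⁻ y in Set.Ico q.1 (peakOf q), f y) ∂stateLaw μ := by
  rw [ageLaw, lintegral_smul_measure, lintegral_map hf measurable_snd, smul_eq_mul,
    ← lintegral_indicator measurableSet_ageRegion,
    lintegral_prod (ageRegion.indicator fun r => f r.2)
      ((hf.comp measurable_snd).indicator measurableSet_ageRegion).aemeasurable]
  congr 1
  refine lintegral_congr fun q => ?_
  rw [← lintegral_indicator measurableSet_Ico]
  rfl

variable (h0 : ∀ᵐ p ∂μ, 0 ≤ p.1 ∧ 0 ≤ p.2) (h1 : Integrable (fun p => p.1) μ)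
  (h2 : Integrable (fun p => p.2) μ) (h12 : ∫ p, p.2 ∂μ < ∫ p, p.1 ∂μ)

include h0 h1 h2 h12

lemma ae_stateLaw_nonneg : ∀ᵐ q ∂stateLaw μ, 0 ≤ q.1 ∧ 0 ≤ q.2.1 ∧ 0 ≤ q.2.2 := by
  filter_upwards [Measure.quasiMeasurePreserving_fst.ae (ae_delayLaw_nonneg h0 h1 h2 h12),
    Measure.quasiMeasurePreserving_snd.ae h0] with q a b
  exact ⟨a, b⟩

lemma ae_delay_le_peakOf : ∀ᵐ q ∂stateLaw μ, q.1 ≤ peakOf q := by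
  filter_upwards [ae_stateLaw_nonneg h0 h1 h2 h12] with q hq
  exact (le_max_left _ _).trans (le_add_of_nonneg_right hq.2.2)

lemma ae_peakLaw_nonneg : ∀ᵐ y ∂peakLaw μ, 0 ≤ y := by
  rw [peakLaw, ae_map_iff measurable_peakOf.aemeasurable measurableSet_Ici]
  filter_upwards [ae_stateLaw_nonneg h0 h1 h2 h12, ae_delay_le_peakOf h0 h1 h2 h12] with q a b
  exact a.1.trans b

/-- The time between departures is at most `G + H`, although the delay itself may have infinite
mean. -/
lemma integrable_peakOf_sub : Integrable (fun q => peakOf q - q.1) (stateLaw μ) := by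
  have h3 : Integrable (fun q : ℝ × (ℝ × ℝ) => q.2.1 + q.2.2) (stateLaw μ) :=
    (h1.add h2).comp_snd (delayLaw μ)
  refine h3.mono' (by fun_prop) ?_
  filter_upwards [ae_stateLaw_nonneg h0 h1 h2 h12, ae_delay_le_peakOf h0 h1 h2 h12] with q a b
  rw [Real.norm_of_nonneg (sub_nonneg.2 b), peakOf]
  have : max q.1 q.2.1 ≤ q.1 + q.2.1 := max_le (by linarith [a.2.1]) (by linarith [a.1])
  linarith

/-- The mean time between departures is the mean interarrival time. -/
lemma integral_peakOf_sub : ∫ q, (peakOf q - q.1) ∂stateLaw μ = ∫ p, p.1 ∂μ := by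
  have hstep : ∀ q : ℝ × (ℝ × ℝ), delayStep q.1 q.2 - q.1 = (peakOf q - q.1) - q.2.1 := by
    intro q
    have : max (q.1 - q.2.1) 0 = max q.1 q.2.1 - q.2.1 := by rw [← max_sub_sub_right, sub_self]
    rw [delayStep, peakOf, this]
    ring
  have hg : Integrable (fun q : ℝ × (ℝ × ℝ) => q.2.1) (stateLaw μ) := h1.comp_snd (delayLaw μ)
  have hp := integrable_peakOf_sub h0 h1 h2 h12
  -- Two successive stationary delays have the same law, so their integrable difference has mean
  -- zero.
  have hz : ∫ q, (delayStep q.1 q.2 - q.1) ∂stateLaw μ = 0 := by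
    refine integral_sub_eq_zero_of_map_eq measurable_delayStep measurable_fst ?_ ?_
    · rw [(measurePreserving_delayStep h0 h1 h2 h12).map_eq, measurePreserving_fst.map_eq]
    · simp only [hstep]
      exact hp.sub hg
  simp only [hstep] at hz
  rw [integral_sub hp hg, sub_eq_zero] at hz
  rw [hz]
  have := integral_map (μ := stateLaw μ) (φ := Prod.snd) measurable_snd.aemeasurable
    (f := fun p : ℝ × ℝ => p.1) measurable_fst.aestronglyMeasurable
  rw [measurePreserving_snd.map_eq] at this
  exact this.symm

/-- Integration with respect to the law of the age, in terms of an antiderivative. -/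
lemma integral_ageLaw {ψ Ψ : ℝ → ℝ} (hψ : Measurable ψ) (hψ0 : ∀ y, 0 ≤ ψ y) (hΨ : Monotone Ψ)
    (h : ∀ a b, a ≤ b → ∫⁻ y in Set.Ico a b, ENNReal.ofReal (ψ y) = ENNReal.ofReal (Ψ b - Ψ a)) :
    ∫ y, ψ y ∂ageLaw μ = (∫ q, (Ψ (peakOf q) - Ψ q.1) ∂stateLaw μ) / ∫ p, p.1 ∂μ := by
  have hle := ae_delay_le_peakOf h0 h1 h2 h12
  have hg : 0 ≤ ∫ p, p.1 ∂μ := integral_nonneg_of_ae (h0.mono fun p hp => hp.1)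
  rw [integral_eq_lintegral_of_nonneg_ae (Eventually.of_forall hψ0) hψ.aestronglyMeasurable,
    lintegral_ageLaw hψ.ennreal_ofReal, integral_eq_lintegral_of_nonneg_ae
      (hle.mono fun q hq => sub_nonneg.2 (hΨ hq))
      ((hΨ.measurable.comp measurable_peakOf).sub
        (hΨ.measurable.comp measurable_fst)).aestronglyMeasurable,
    lintegral_congr_ae (hle.mono fun q hq => h _ _ hq), ENNReal.toReal_mul,
    ENNReal.toReal_ofReal (inv_nonneg.2 hg), div_eq_inv_mul]

/-- The mass of `ageRegion` is the mean time between departures, which is `E[G]`, the normalising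
constant. -/
lemma isProbabilityMeasure_ageLaw (hpos : 0 < ∫ p, p.1 ∂μ) :
    IsProbabilityMeasure (ageLaw μ) := by
  have hle := ae_delay_le_peakOf h0 h1 h2 h12
  refine ⟨?_⟩
  rw [← lintegral_one, lintegral_ageLaw measurable_const]
  simp only [lintegral_const, one_mul, Measure.restrict_apply_univ, Real.volume_Ico]
  rw [← ofReal_integral_eq_lintegral_ofReal (integrable_peakOf_sub h0 h1 h2 h12)
    (hle.mono fun q hq => sub_nonneg.2 hq), integral_peakOf_sub h0 h1 h2 h12,
    ← ENNReal.ofReal_mul (inv_nonneg.2 hpos.le), inv_mul_cancel₀ hpos.ne', ENNReal.ofReal_one]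

lemma ageLaw_Iio_zero : ageLaw μ (Set.Iio 0) = 0 := by
  rw [← lintegral_indicator_one measurableSet_Iio,
    lintegral_ageLaw (measurable_one.indicator measurableSet_Iio)]
  have : ∀ᵐ q ∂stateLaw μ, ∫⁻ y in Set.Ico q.1 (peakOf q),
      (Set.Iio (0 : ℝ)).indicator (1 : ℝ → ENNReal) y = 0 := by
    filter_upwards [ae_stateLaw_nonneg h0 h1 h2 h12] with q hq
    rw [lintegral_indicator_one measurableSet_Iio, Measure.restrict_apply measurableSet_Iio]
    convert measure_empty (μ := (volume : Measure ℝ))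
    ext y
    simp only [Set.mem_inter_iff, Set.mem_Iio, Set.mem_Ico, Set.mem_empty_iff_false, iff_false]
    intro h
    linarith [hq.1, h.2.1]
  rw [lintegral_congr_ae this, lintegral_zero, mul_zero]

/-- `min y x` serves as antiderivative of the indicator of `Iic x`. -/
lemma cdf_ageLaw (hpos : 0 < ∫ p, p.1 ∂μ) (x : ℝ) :
    cdf (ageLaw μ) x = (∫ q, (min (peakOf q) x - min q.1 x) ∂stateLaw μ) / ∫ p, p.1 ∂μ := by
  have := isProbabilityMeasure_ageLaw h0 h1 h2 h12 hpos
  rw [cdf_eq_real, ← integral_indicator_one measurableSet_Iic]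
  refine integral_ageLaw h0 h1 h2 h12 (Ψ := fun y => min y x)
    (measurable_one.indicator measurableSet_Iic) (fun y => Set.indicator_nonneg (by simp) y)
    (fun a b hab => min_le_min_right x hab) fun a b hab => ?_
  have hind : ∀ y, ENNReal.ofReal ((Set.Iic x).indicator (1 : ℝ → ℝ) y)
      = (Set.Iic x).indicator (1 : ℝ → ENNReal) y := by
    intro y
    by_cases hy : y ∈ Set.Iic x <;> simp [hy]
  simp only [hind]
  rw [lintegral_indicator_one measurableSet_Iic, Measure.restrict_apply measurableSet_Iic,
    Set.inter_comm]
  rcases le_total x a with hxa | hxa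
  · have hs : Set.Ico a b ∩ Set.Iic x ⊆ {x} := fun y hy =>
      le_antisymm hy.2 (hxa.trans hy.1.1)
    rw [measure_mono_null hs (measure_singleton x), min_eq_right hxa,
      min_eq_right (hxa.trans hab), sub_self, ENNReal.ofReal_zero]
  · rw [min_eq_left hxa]
    rcases le_total b x with hbx | hbx
    · rw [Set.inter_eq_left.2 (fun y hy => hy.2.le.trans hbx), Real.volume_Ico, min_eq_left hbx]
    · rw [min_eq_right hbx]
      apply le_antisymm
      · exact (measure_mono fun y hy => (⟨hy.1.1, hy.2⟩ : y ∈ Set.Icc a x)).trans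
          Real.volume_Icc.le
      · rw [← Real.volume_Ico]
        exact measure_mono fun y hy => ⟨⟨hy.1, hy.2.trans_le hbx⟩, hy.2.le⟩

/-- The transform of the age. -/
lemma lst_ageLaw {s : ℝ} (hs : 0 < s) :
    lst (ageLaw μ) s = (lst (delayLaw μ) s - lst (peakLaw μ) s) / (s * ∫ p, p.1 ∂μ) := by
  have hexp : Measurable fun y : ℝ => Real.exp (-s * y) := by fun_prop
  have h3 := integral_ageLaw h0 h1 h2 h12 (Ψ := fun y => -Real.exp (-s * y) / s) hexp
    (fun y => (Real.exp_pos _).le)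
    (fun a b hab => div_le_div_of_nonneg_right (neg_le_neg (Real.exp_le_exp.2
      (mul_le_mul_of_nonpos_left hab (neg_nonpos.2 hs.le)))) hs.le) fun a b hab => by
        have hderiv : ∀ y ∈ Set.uIcc a b, HasDerivAt (fun y => -Real.exp (-s * y) / s)
            (Real.exp (-s * y)) y := by
          intro y _
          have h4 := ((((hasDerivAt_id y).const_mul (-s)).exp).neg).div_const s
          exact h4.congr_deriv (by simp only [id]; field_simp)
        have hcont : Continuous fun y : ℝ => Real.exp (-s * y) := by fun_prop
        rw [← intervalIntegral.integral_eq_sub_of_hasDerivAt hderiv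
          (hcont.intervalIntegrable a b), intervalIntegral.integral_of_le hab,
          ← integral_Ico_eq_integral_Ioc, ofReal_integral_eq_lintegral_ofReal
            ((hcont.integrableOn_Icc).mono_set Set.Ico_subset_Icc_self)
            (Eventually.of_forall fun y => (Real.exp_pos _).le)]
  have hle : ∀ y, 0 ≤ y → ‖Real.exp (-s * y)‖ ≤ 1 := fun y hy => by
    rw [Real.norm_of_nonneg (Real.exp_pos _).le]
    exact Real.exp_le_one_iff.2 (by nlinarith)
  have hid : Integrable (fun q : ℝ × (ℝ × ℝ) => Real.exp (-s * q.1)) (stateLaw μ) :=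
    Integrable.of_bound (by fun_prop) 1
      ((ae_stateLaw_nonneg h0 h1 h2 h12).mono fun q hq => hle _ hq.1)
  have hip : Integrable (fun q : ℝ × (ℝ × ℝ) => Real.exp (-s * peakOf q)) (stateLaw μ) := by
    refine Integrable.of_bound (by fun_prop) 1 ?_
    filter_upwards [ae_stateLaw_nonneg h0 h1 h2 h12, ae_delay_le_peakOf h0 h1 h2 h12] with q a b
    exact hle _ (a.1.trans b)
  have hd : lst (delayLaw μ) s = ∫ q, Real.exp (-s * q.1) ∂stateLaw μ := by
    have := integral_map (μ := stateLaw μ) (φ := Prod.fst) measurable_fst.aemeasurable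
      hexp.aestronglyMeasurable
    rwa [measurePreserving_fst.map_eq] at this
  have hp : lst (peakLaw μ) s = ∫ q, Real.exp (-s * peakOf q) ∂stateLaw μ :=
    integral_map measurable_peakOf.aemeasurable hexp.aestronglyMeasurable
  rw [lst, h3, hd, hp, ← integral_sub hid hip, ← div_div, ← integral_div s]
  congr 1
  refine integral_congr_ae (Eventually.of_forall fun q => ?_)
  ring

end Law

/-- The transform of the peak age. -/
lemma lst_peakLaw {μG μH : Measure ℝ} [IsProbabilityMeasure μG] [IsProbabilityMeasure μH]
    (hG : ∀ᵐ x ∂μG, 0 ≤ x) (hD : ∀ᵐ x ∂delayLaw (μG.prod μH), 0 ≤ x) {s : ℝ} (hs : 0 < s) :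
    lst (peakLaw (μG.prod μH)) s =
      ((∫ x, Real.exp (-s * x) * cdf μG x ∂delayLaw (μG.prod μH))
        + (∫ x, Real.exp (-s * x) * cdf (delayLaw (μG.prod μH)) x ∂μG)
        - ∫ p : ℝ × ℝ, Set.indicator {q : ℝ × ℝ | q.1 = q.2}
            (fun q => Real.exp (-s * q.1)) p ∂(μG.prod (delayLaw (μG.prod μH))))
      * lst μH s := by
  set μD := delayLaw (μG.prod μH) with hμD
  have hexp : Measurable fun y : ℝ => Real.exp (-s * y) := by fun_prop
  have hle : ∀ y, 0 ≤ y → ‖Real.exp (-s * y)‖ ≤ 1 := fun y hy => by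
    rw [Real.norm_of_nonneg (Real.exp_pos _).le]
    exact Real.exp_le_one_iff.2 (by nlinarith)
  have hnn : ∀ᵐ p ∂μD.prod μG, 0 ≤ p.1 ∧ 0 ≤ p.2 :=
    (Measure.quasiMeasurePreserving_fst.ae hD).and (Measure.quasiMeasurePreserving_snd.ae hG)
  have hassoc := (measurePreserving_prodAssoc μD μG μH).map_eq
  -- The service time is independent of `max D G`, so its transform factors out.
  have hfactor : lst (peakLaw (μG.prod μH)) s
      = (∫ p : ℝ × ℝ, Real.exp (-s * max p.1 p.2) ∂μD.prod μG) * lst μH s := by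
    rw [lst, peakLaw, integral_map measurable_peakOf.aemeasurable hexp.aestronglyMeasurable,
      stateLaw, ← hμD, ← hassoc, integral_map (by fun_prop) (by fun_prop), lst,
      ← integral_prod_mul]
    refine integral_congr_ae (Eventually.of_forall fun r => ?_)
    simp only [peakOf, MeasurableEquiv.prodAssoc, MeasurableEquiv.coe_mk, Equiv.prodAssoc_apply]
    rw [← Real.exp_add]
    ring_nf
  rw [hfactor]
  congr 1
  set A : Set (ℝ × ℝ) := {p | p.2 ≤ p.1} with hA
  set B : Set (ℝ × ℝ) := {p | p.1 ≤ p.2} with hB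
  set E : Set (ℝ × ℝ) := {p | p.1 = p.2} with hE
  have hAm : MeasurableSet A := measurableSet_le measurable_snd measurable_fst
  have hBm : MeasurableSet B := measurableSet_le measurable_fst measurable_snd
  have hEm : MeasurableSet E := measurableSet_eq_fun measurable_fst measurable_snd
  have hi1 : Integrable (fun p : ℝ × ℝ => Real.exp (-s * p.1)) (μD.prod μG) :=
    Integrable.of_bound (by fun_prop) 1 (hnn.mono fun p hp => hle _ hp.1)
  have hi2 : Integrable (fun p : ℝ × ℝ => Real.exp (-s * p.2)) (μD.prod μG) :=
    Integrable.of_bound (by fun_prop) 1 (hnn.mono fun p hp => hle _ hp.2)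
  -- The closed half-planes `G ≤ D` and `D ≤ G` overlap on the diagonal, which is therefore
  -- subtracted once.
  have hsplit : ∀ p : ℝ × ℝ, Real.exp (-s * max p.1 p.2)
      = A.indicator (fun p => Real.exp (-s * p.1)) p + B.indicator (fun p => Real.exp (-s * p.2)) p
        - E.indicator (fun p => Real.exp (-s * p.2)) p := by
    intro p
    rcases lt_trichotomy p.1 p.2 with h | h | h
    · have a : p ∉ A := not_le.2 h
      have b : p ∈ B := h.le
      have e : p ∉ E := h.ne
      simp [a, b, e, max_eq_right h.le]
    · have a : p ∈ A := h.ge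
      have b : p ∈ B := h.le
      have e : p ∈ E := h
      simp [a, b, e, h]
    · have a : p ∈ A := h.le
      have b : p ∉ B := not_le.2 h
      have e : p ∉ E := h.ne'
      simp [a, b, e, max_eq_left h.le]
  simp only [hsplit]
  have hAB : Integrable (fun p => A.indicator (fun p : ℝ × ℝ => Real.exp (-s * p.1)) p +
      B.indicator (fun p => Real.exp (-s * p.2)) p) (μD.prod μG) :=
    (hi1.indicator hAm).add (hi2.indicator hBm)
  rw [integral_sub hAB (hi2.indicator hEm), integral_add (hi1.indicator hAm) (hi2.indicator hBm)]
  congr 1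
  · congr 1
    · rw [integral_prod _ (hi1.indicator hAm)]
      refine integral_congr_ae (Eventually.of_forall fun d => ?_)
      have : (fun g => A.indicator (fun p : ℝ × ℝ => Real.exp (-s * p.1)) (d, g))
          = (Set.Iic d).indicator fun _ => Real.exp (-s * d) := rfl
      simp only [this]
      rw [integral_indicator_const _ measurableSet_Iic, cdf_eq_real, smul_eq_mul, mul_comm]
    · rw [integral_prod_symm _ (hi2.indicator hBm)]
      refine integral_congr_ae (Eventually.of_forall fun g => ?_)
      have : (fun d => B.indicator (fun p : ℝ × ℝ => Real.exp (-s * p.2)) (d, g))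
          = (Set.Iic g).indicator fun _ => Real.exp (-s * g) := rfl
      simp only [this]
      rw [integral_indicator_const _ measurableSet_Iic, cdf_eq_real, smul_eq_mul, mul_comm]
  · rw [← integral_prod_swap]
    refine integral_congr_ae (Eventually.of_forall fun p => ?_)
    by_cases h : p.1 = p.2
    · simp [hE, Set.indicator, h]
    · simp [hE, Set.indicator, h, Ne.symm h]

/-! ### Limits of averages -/

/-- The long-run rate of a monotone function, read off along a sequence of linear growth. -/
lemma tendsto_div_of_monotone_of_seq {I : ℝ → ℝ} (hI : Monotone I) {b : ℕ → ℝ} {g c : ℝ}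
    (hg : 0 < g) (hb : Tendsto (fun n : ℕ => b n / n) atTop (𝓝 g))
    (hIb : Tendsto (fun n : ℕ => I (b n) / n) atTop (𝓝 c)) :
    Tendsto (fun T => I T / T) atTop (𝓝 (c / g)) := by
  have hcont : Tendsto (fun l : ℝ => c * l⁻¹) (𝓝 g) (𝓝 (c / g)) := by
    rw [div_eq_mul_inv]
    exact (tendsto_inv₀ hg.ne').const_mul c
  have hrate : ∀ (N : ℝ → ℕ) (l : ℝ), Tendsto N atTop atTop →
      Tendsto (fun T : ℝ => (N T : ℝ) / T) atTop (𝓝 l⁻¹) →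
      Tendsto (fun T : ℝ => I (b (N T)) / T) atTop (𝓝 (c * l⁻¹)) := by
    intro N l hN hNT
    refine ((hIb.comp hN).mul hNT).congr' ?_
    filter_upwards [hN.eventually (eventually_gt_atTop 0)] with T hT
    have : (N T : ℝ) ≠ 0 := by exact_mod_cast hT.ne'
    simp only [Function.comp_apply]
    field_simp
  rw [tendsto_order]
  constructor
  · intro a ha
    -- For `l` slightly above `g` and `N = ⌊T / l⌋`, eventually `b N ≤ l * N ≤ T`, so `I (b N) ≤ I
    -- T`, while `I (b N) / T` tends to `c / l`. The upper bound uses `l` below `g` and the ceiling.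
    obtain ⟨l, hl, hgl⟩ := (((hcont.eventually (lt_mem_nhds ha)).filter_mono
      nhdsWithin_le_nhds).and (self_mem_nhdsWithin (s := Set.Ioi g))).exists
    have hl0 : 0 < l := hg.trans hgl
    have hN : Tendsto (fun T : ℝ => ⌊l⁻¹ * T⌋₊) atTop atTop :=
      tendsto_nat_floor_atTop.comp (tendsto_id.const_mul_atTop (inv_pos.2 hl0))
    have hlim := hrate _ l hN (tendsto_nat_floor_mul_div_atTop (inv_nonneg.2 hl0.le))
    filter_upwards [hlim.eventually (lt_mem_nhds hl), eventually_gt_atTop 0,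
      hN.eventually ((hb.eventually (gt_mem_nhds hgl)).and (eventually_gt_atTop 0))]
      with T h1 hT h2
    refine h1.trans_le (div_le_div_of_nonneg_right (hI ?_) hT.le)
    have h3 : (0 : ℝ) < (⌊l⁻¹ * T⌋₊ : ℝ) := by exact_mod_cast h2.2
    calc b ⌊l⁻¹ * T⌋₊ ≤ l * ⌊l⁻¹ * T⌋₊ := ((div_lt_iff₀ h3).1 h2.1).le
      _ ≤ l * (l⁻¹ * T) :=
        mul_le_mul_of_nonneg_left (Nat.floor_le (by positivity)) hl0.le
      _ = T := by field_simp
  · intro a ha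
    obtain ⟨l, ⟨hl, hl0⟩, hgl⟩ := ((((hcont.eventually (gt_mem_nhds ha)).and
      (lt_mem_nhds hg)).filter_mono nhdsWithin_le_nhds).and
      (self_mem_nhdsWithin (s := Set.Iio g))).exists
    have hN : Tendsto (fun T : ℝ => ⌈l⁻¹ * T⌉₊) atTop atTop :=
      tendsto_nat_ceil_atTop.comp (tendsto_id.const_mul_atTop (inv_pos.2 hl0))
    have hlim := hrate _ l hN (tendsto_nat_ceil_mul_div_atTop (inv_nonneg.2 hl0.le))
    filter_upwards [hlim.eventually (gt_mem_nhds hl), eventually_gt_atTop 0,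
      hN.eventually ((hb.eventually (lt_mem_nhds hgl)).and (eventually_gt_atTop 0))]
      with T h1 hT h2
    refine (div_le_div_of_nonneg_right (hI ?_) hT.le).trans_lt h1
    have h3 : (0 : ℝ) < (⌈l⁻¹ * T⌉₊ : ℝ) := by exact_mod_cast h2.2
    calc T = l * (l⁻¹ * T) := by field_simp
      _ ≤ l * ⌈l⁻¹ * T⌉₊ := mul_le_mul_of_nonneg_left (Nat.le_ceil _) hl0.le
      _ ≤ b ⌈l⁻¹ * T⌉₊ := ((lt_div_iff₀ h3).1 h2.1).le

/-- Monotone functions that converge almost surely at each point to a fixed monotone function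
converge almost surely at all points. -/
lemma ae_forall_tendsto_of_monotone {Ω ι : Type*} [MeasurableSpace Ω] {P : Measure Ω}
    {l : Filter ι} {F : Ω → ι → ℝ → ℝ} {L : ℝ → ℝ}
    (hF : ∀ᵐ ω ∂P, ∀ᶠ i in l, Monotone (F ω i)) (hL : Monotone L)
    (h : ∀ x, ∀ᵐ ω ∂P, Tendsto (fun i => F ω i x) l (𝓝 (L x))) :
    ∀ᵐ ω ∂P, ∀ x, Tendsto (fun i => F ω i x) l (𝓝 (L x)) := by
  have hQ : ∀ᵐ ω ∂P, ∀ r : ℚ, Tendsto (fun i => F ω i r) l (𝓝 (L r)) :=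
    ae_all_iff.2 fun r => h r
  -- The discontinuities of `L` are countable, so convergence at all of them costs one null set; at
  -- continuity points, rationals on either side squeeze the value.
  have hdisc : ∀ᵐ ω ∂P, ∀ x ∈ {x | ¬ ContinuousAt L x},
      Tendsto (fun i => F ω i x) l (𝓝 (L x)) :=
    (ae_ball_iff hL.countable_not_continuousAt).2 fun x _ => h x
  filter_upwards [hF, hQ, hdisc] with ω hmono hrat hdis x
  by_cases hx : ContinuousAt L x
  · rw [tendsto_order]
    constructor
    · intro a ha
      obtain ⟨y, hy, hyx⟩ := (((hx.eventually (lt_mem_nhds ha)).filter_mono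
        nhdsWithin_le_nhds).and (self_mem_nhdsWithin (s := Set.Iio x))).exists
      obtain ⟨r, hr1, hr2⟩ := exists_rat_btwn (show y < x from hyx)
      filter_upwards [hmono, (hrat r).eventually (lt_mem_nhds (hy.trans_le (hL hr1.le)))]
        with i hi1 hi2
      exact hi2.trans_le (hi1 hr2.le)
    · intro a ha
      obtain ⟨y, hy, hyx⟩ := (((hx.eventually (gt_mem_nhds ha)).filter_mono
        nhdsWithin_le_nhds).and (self_mem_nhdsWithin (s := Set.Ioi x))).exists
      obtain ⟨r, hr1, hr2⟩ := exists_rat_btwn (show x < y from hyx)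
      filter_upwards [hmono, (hrat r).eventually (gt_mem_nhds ((hL hr2.le).trans_lt hy))]
        with i hi1 hi2
      exact (hi1 hr1.le).trans_lt hi2
  · exact hdis x hx

lemma indicator_Iic_mono (t : ℝ) :
    Monotone fun x : ℝ => (Set.Iic x).indicator (fun _ => (1 : ℝ)) t := fun _ _ hxy =>
  Set.indicator_le_indicator_of_subset (Set.Iic_subset_Iic.2 hxy) (fun _ => zero_le_one) t

lemma indicator_Iic_nonneg (x t : ℝ) : 0 ≤ (Set.Iic x).indicator (fun _ => (1 : ℝ)) t :=
  Set.indicator_nonneg (fun _ _ => zero_le_one) t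

lemma indicator_Iic_le_one (x t : ℝ) : (Set.Iic x).indicator (fun _ => (1 : ℝ)) t ≤ 1 :=
  Set.indicator_le_self' (f := fun _ : ℝ => (1 : ℝ)) (fun _ _ => zero_le_one) t

lemma abs_indicator_Iic_le_one (x t : ℝ) : |(Set.Iic x).indicator (fun _ => (1 : ℝ)) t| ≤ 1 := by
  rw [abs_of_nonneg (indicator_Iic_nonneg x t)]
  exact indicator_Iic_le_one x t

@[fun_prop]
lemma measurable_indicator_Iic (x : ℝ) :
    Measurable ((Set.Iic x).indicator fun _ => (1 : ℝ)) :=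
  measurable_const.indicator measurableSet_Iic

lemma intervalIntegrable_indicator_Iic {f : ℝ → ℝ} (hf : Measurable f) (x a b : ℝ) :
    IntervalIntegrable (fun t => (Set.Iic x).indicator (fun _ => (1 : ℝ)) (f t)) volume a b := by
  rw [intervalIntegrable_iff]
  have : IsFiniteMeasure (volume.restrict (Set.uIoc a b)) := by
    rw [Set.uIoc]; infer_instance
  exact Integrable.of_bound ((measurable_indicator_Iic x).comp hf).aestronglyMeasurable 1
    (Eventually.of_forall fun t => abs_indicator_Iic_le_one x _)

lemma intervalIntegral_indicator_Iic {a b : ℝ} (hab : a ≤ b) (x : ℝ) :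
    ∫ t in a..b, (Set.Iic x).indicator (fun _ => (1 : ℝ)) t = min b x - min a x := by
  rw [intervalIntegral.integral_of_le hab, integral_indicator_const _ measurableSet_Iic,
    smul_eq_mul, mul_one, Measure.real, Measure.restrict_apply measurableSet_Iic, Set.inter_comm,
    Set.Ioc_inter_Iic, Real.volume_Ioc]
  rcases le_total a x with h | h
  · rw [min_eq_left h, ENNReal.toReal_ofReal (sub_nonneg.2 (le_min hab h))]
  · rw [min_eq_right h, min_eq_right (h.trans hab), sub_self,
      ENNReal.ofReal_of_nonpos (by linarith), ENNReal.toReal_zero]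

/-! ### Identification of stationary laws -/

lemma hasLaw_of_cdf {Ω : Type*} [MeasurableSpace Ω] {P : Measure Ω} [IsProbabilityMeasure P]
    {Y : Ω → ℝ} (hY : AEMeasurable Y P) {ν : Measure ℝ} [IsProbabilityMeasure ν]
    (h : ∀ x, ∫ ω, (Set.Iic x).indicator (fun _ => (1 : ℝ)) (Y ω) ∂P = cdf ν x) :
    HasLaw Y ν P := by
  have := Measure.isProbabilityMeasure_map hY
  refine ⟨hY, Measure.eq_of_cdf _ _ ?_⟩
  ext x
  rw [← h x, cdf_eq_real, ← integral_map hY (measurable_indicator_Iic x).aestronglyMeasurable,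
    integral_indicator_const _ measurableSet_Iic, smul_eq_mul, mul_one]

lemma integral_indicator_eq_of_identDistrib {Ω : Type*} [MeasurableSpace Ω] {P : Measure Ω}
    {Y Z : Ω → ℝ} (h : IdentDistrib Y Z P P) (x : ℝ) :
    ∫ ω, (Set.Iic x).indicator (fun _ => (1 : ℝ)) (Y ω) ∂P
      = ∫ ω, (Set.Iic x).indicator (fun _ => (1 : ℝ)) (Z ω) ∂P :=
  (h.comp (measurable_indicator_Iic x)).integral_eq

/-- Bounded averages that converge almost surely to a constant and have constant mean. -/
lemma eq_of_ae_tendsto_of_integral_eq {Ω : Type*} [MeasurableSpace Ω] {P : Measure Ω}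
    [IsProbabilityMeasure P] {X : ℕ → Ω → ℝ} {c p : ℝ}
    (hX : ∀ n, AEStronglyMeasurable (X n) P) (hb : ∀ n ω, |X n ω| ≤ 1)
    (hlim : ∀ᵐ ω ∂P, Tendsto (fun n => X n ω) atTop (𝓝 c))
    (hint : ∀ n, 0 < n → ∫ ω, X n ω ∂P = p) : p = c := by
  have h := tendsto_integral_of_dominated_convergence (μ := P) (fun _ => (1 : ℝ)) hX
    (integrable_const 1) (fun n => Eventually.of_forall fun ω => hb n ω) hlim
  simp only [integral_const, probReal_univ, one_smul] at h
  refine tendsto_nhds_unique (tendsto_const_nhds.congr' ?_) h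
  filter_upwards [eventually_gt_atTop 0] with n hn using (hint n hn).symm

/-- A sequence of identically distributed variables with an asymptotic frequency distribution has
that distribution. -/
lemma hasLaw_of_hasSeqFrequency {Ω : Type*} [MeasurableSpace Ω] {P : Measure Ω}
    [IsProbabilityMeasure P] {U : ℤ → Ω → ℝ} {ν : Measure ℝ} [IsProbabilityMeasure ν]
    (hfreq : ∀ᵐ ω ∂P, HasSeqFrequency (fun n => U n ω) ν)
    (hU : ∀ n, 1 ≤ n → IdentDistrib (U n) (U 1) P P) (n : ℤ) (hn : 1 ≤ n) :
    HasLaw (U n) ν P := by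
  have hm : ∀ (x : ℝ) (k : ℤ), 1 ≤ k → Integrable
      (fun ω => (Set.Iic x).indicator (fun _ => (1 : ℝ)) (U k ω)) P := fun x k hk =>
    Integrable.of_bound ((measurable_indicator_Iic x).comp_aemeasurable
      (hU k hk).aemeasurable_fst).aestronglyMeasurable 1
      (Eventually.of_forall fun ω => abs_indicator_Iic_le_one x _)
  refine hasLaw_of_cdf (hU n hn).aemeasurable_fst fun x => ?_
  rw [integral_indicator_eq_of_identDistrib (hU n hn) x]
  have hsum : ∀ N : ℕ, Integrable (fun ω => ∑ n ∈ Finset.Icc 1 N,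
      (Set.Iic x).indicator (fun _ => (1 : ℝ)) (U (n : ℤ) ω)) P := fun N =>
    integrable_finsetSum _ fun (k : ℕ) hk => hm x k (by exact_mod_cast (Finset.mem_Icc.1 hk).1)
  refine eq_of_ae_tendsto_of_integral_eq (P := P) (X := fun (N : ℕ) ω => (1 / (N : ℝ)) *
    ∑ n ∈ Finset.Icc 1 N, (Set.Iic x).indicator (fun _ => (1 : ℝ)) (U (n : ℤ) ω))
    (fun N => ((hsum N).const_mul _).aestronglyMeasurable) (fun N ω => ?_)
    (hfreq.mono fun ω h => h x) fun N hN => ?_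
  · rw [abs_mul, abs_of_nonneg (by positivity : (0 : ℝ) ≤ 1 / N), one_div]
    refine inv_mul_le_one_of_le₀ ?_ (Nat.cast_nonneg N)
    refine (Finset.abs_sum_le_sum_abs _ _).trans ((Finset.sum_le_sum fun k _ =>
      abs_indicator_Iic_le_one x _).trans ?_)
    simp
  · rw [integral_const_mul, integral_finsetSum _ fun (k : ℕ) hk =>
      hm x k (by exact_mod_cast (Finset.mem_Icc.1 hk).1),
      Finset.sum_congr rfl fun (k : ℕ) hk => integral_indicator_eq_of_identDistrib
        (hU k (by exact_mod_cast (Finset.mem_Icc.1 hk).1)) x]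
    have : (N : ℝ) ≠ 0 := by exact_mod_cast hN.ne'
    simp only [Finset.sum_const, Nat.card_Icc, Nat.add_sub_cancel, nsmul_eq_mul]
    field_simp

/-- A process of identically distributed variables with an asymptotic frequency distribution has
that distribution, if it has a jointly measurable version. -/
lemma hasLaw_of_hasTimeFrequency {Ω : Type*} [MeasurableSpace Ω] {P : Measure Ω}
    [IsProbabilityMeasure P] {U : ℝ → Ω → ℝ} {V : ℝ × Ω → ℝ} (hV : Measurable V)
    (hUV : ∀ᵐ ω ∂P, ∀ t, U t ω = V (t, ω)) {ν : Measure ℝ} [IsProbabilityMeasure ν]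
    (hfreq : ∀ᵐ ω ∂P, HasTimeFrequency (fun t => U t ω) ν)
    (hU : ∀ t, 0 ≤ t → IdentDistrib (U t) (U 0) P P) (t : ℝ) (ht : 0 ≤ t) :
    HasLaw (U t) ν P := by
  refine hasLaw_of_cdf (hU t ht).aemeasurable_fst fun x => ?_
  rw [integral_indicator_eq_of_identDistrib (hU t ht) x]
  set f : ℝ → Ω → ℝ := fun t ω => (Set.Iic x).indicator (fun _ => (1 : ℝ)) (V (t, ω)) with hf
  have hfm : Measurable (Function.uncurry f) := (measurable_indicator_Iic x).comp hV
  have hfint : ∀ T : ℝ, Integrable (Function.uncurry f)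
      ((volume.restrict (Set.Ioc 0 T)).prod P) := fun T =>
    Integrable.of_bound hfm.aestronglyMeasurable 1
      (Eventually.of_forall fun p => abs_indicator_Iic_le_one x _)
  have hmean : ∀ s, 0 ≤ s → ∫ ω, f s ω ∂P
      = ∫ ω, (Set.Iic x).indicator (fun _ => (1 : ℝ)) (U 0 ω) ∂P := by
    intro s hs
    rw [← integral_indicator_eq_of_identDistrib (hU s hs) x]
    exact integral_congr_ae (hUV.mono fun ω h => by simp only [hf, h s])
  -- By Fubini, which needs the jointly measurable `V`, the time average over `(0, N]` has mean
  -- independent of `N`.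
  refine eq_of_ae_tendsto_of_integral_eq (P := P)
    (X := fun (N : ℕ) ω => (1 / (N : ℝ)) * ∫ t in Set.Ioc (0 : ℝ) N, f t ω)
    (fun N => ((hfint N).integral_prod_right.const_mul _).aestronglyMeasurable) (fun N ω => ?_)
    ?_ fun N hN => ?_
  · rw [abs_mul, abs_of_nonneg (by positivity : (0 : ℝ) ≤ 1 / N), one_div]
    refine inv_mul_le_one_of_le₀ ?_ (Nat.cast_nonneg N)
    have := norm_setIntegral_le_of_norm_le_const (μ := volume) (s := Set.Ioc (0 : ℝ) N)
      (f := fun t => f t ω) (C := 1) (by simp) fun t _ => abs_indicator_Iic_le_one x _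
    simpa using this
  · filter_upwards [hfreq, hUV] with ω h1 h2
    refine ((h1 x).comp tendsto_natCast_atTop_atTop).congr fun N => ?_
    simp only [Function.comp_apply, h2]
    rw [intervalIntegral.integral_of_le (Nat.cast_nonneg N)]
  · rw [integral_const_mul, ← integral_integral_swap (hfint N),
      setIntegral_congr_fun measurableSet_Ioc fun s hs => hmean s hs.1.le]
    have : (N : ℝ) ≠ 0 := by exact_mod_cast hN.ne'
    simp only [integral_const, MeasurableSet.univ, measureReal_restrict_apply, Set.univ_inter,
      Real.volume_real_Ioc_of_le (Nat.cast_nonneg N), sub_zero, smul_eq_mul]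
    field_simp

/-! ### Sample paths of the queue -/

section Path

variable {Ω : Type*} {α β H : ℤ → Ω → ℝ} {ω : Ω}

/-- The sample point `ω` obeys the rules of the queue. -/
structure IsFCFSPath (α β H : ℤ → Ω → ℝ) (ω : Ω) : Prop where
  arrival_le : ∀ n, α (n - 1) ω ≤ α n ω
  service_nonneg : ∀ n, 0 ≤ H n ω
  departure_eq : ∀ n, β n ω = max (β (n - 1) ω) (α n ω) + H n ω

/-- The interarrival and service times of the packets `2, 3, …`. -/
def inputs (α H : ℤ → Ω → ℝ) (ω : Ω) (k : ℕ) : ℝ × ℝ :=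
  -- The index starts at 2 because the interval before packet 1 is unrestricted; the delay of packet
  -- 1 plays the part of an arbitrary initial value.
  (interarrival α (k + 2) ω, H (k + 2) ω)

namespace IsFCFSPath

lemma monotone_arrival (h : IsFCFSPath α β H ω) : Monotone fun n => α n ω :=
  monotone_int_of_le_succ fun n => by simpa using h.arrival_le (n + 1)

lemma monotone_departure (h : IsFCFSPath α β H ω) : Monotone fun n => β n ω :=
  monotone_int_of_le_succ fun n => by
    have h1 := h.departure_eq (n + 1)
    rw [add_sub_cancel_right] at h1
    rw [h1]
    exact (le_max_left _ _).trans (le_add_of_nonneg_right (h.service_nonneg _))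

lemma arrival_le_departure (h : IsFCFSPath α β H ω) (n : ℤ) : α n ω ≤ β n ω := by
  rw [h.departure_eq n]
  exact (le_max_right _ _).trans (le_add_of_nonneg_right (h.service_nonneg _))

lemma delay_nonneg (h : IsFCFSPath α β H ω) (n : ℤ) : 0 ≤ delay α β n ω :=
  sub_nonneg.2 (h.arrival_le_departure n)

lemma delay_eq_delayStep (h : IsFCFSPath α β H ω) (n : ℤ) :
    delay α β n ω = delayStep (delay α β (n - 1) ω) (interarrival α n ω, H n ω) := by
  simp only [delay, delayStep, interarrival]
  rw [h.departure_eq n, sub_sub_sub_cancel_right, ← sub_self (α n ω), max_sub_sub_right]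
  ring

lemma peakAge_eq_peakOf (h : IsFCFSPath α β H ω) (n : ℤ) :
    peakAge α β n ω = peakOf (delay α β (n - 1) ω, (interarrival α n ω, H n ω)) := by
  simp only [delay, peakOf, interarrival, peakAge]
  rw [h.departure_eq n, max_sub_sub_right]
  ring

lemma delay_eq_delayPath (h : IsFCFSPath α β H ω) (k : ℕ) :
    delay α β (k + 1) ω = delayPath (delay α β 1 ω) (inputs α H ω) k := by
  induction k with
  | zero => simp [delayPath]
  | succ k ih =>
    rw [delayPath, ← ih, h.delay_eq_delayStep]
    push_cast
    rw [add_sub_cancel_right, inputs, add_assoc]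
    rfl

lemma peakAge_eq (h : IsFCFSPath α β H ω) (k : ℕ) :
    peakAge α β (k + 2) ω
      = peakOf (delayPath (delay α β 1 ω) (inputs α H ω) k, inputs α H ω k) := by
  rw [h.peakAge_eq_peakOf, ← h.delay_eq_delayPath, inputs]
  congr 3
  ring

lemma departure_eq_sum (h : IsFCFSPath α β H ω) (n : ℕ) :
    β (n + 1) ω = α 1 ω + ∑ k ∈ Finset.range n, (inputs α H ω k).1
      + delayPath (delay α β 1 ω) (inputs α H ω) n := by
  have hα : α (n + 1) ω = α 1 ω + ∑ k ∈ Finset.range n, (inputs α H ω k).1 := by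
    induction n with
    | zero => simp
    | succ n ih =>
      rw [Finset.sum_range_succ, ← add_assoc, ← ih, inputs, interarrival]
      push_cast
      rw [show (n : ℤ) + 2 - 1 = n + 1 by ring, show (n : ℤ) + 1 + 1 = n + 2 by ring]
      ring
  rw [← h.delay_eq_delayPath, delay, ← hα]
  ring

lemma tendsto_departure_div (h : IsFCFSPath α β H ω) {g m : ℝ}
    (hz : IsTypical g m (inputs α H ω)) (hgm : m < g) :
    Tendsto (fun n : ℕ => β (n + 1) ω / n) atTop (𝓝 g) := by
  have h1 := ((tendsto_const_div_atTop_nhds_zero_nat (α 1 ω)).add hz.tendsto_fst).add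
    (hz.tendsto_delayPath_div hgm (h.delay_nonneg 1))
  rw [zero_add, add_zero] at h1
  refine h1.congr fun n => ?_
  rw [h.departure_eq_sum, add_div, add_div]

/-- Between two departures the age grows from the arrival time of the packet last departed. -/
lemma age_eq (h : IsFCFSPath α β H ω) {n : ℤ} {t : ℝ} (h1 : β n ω ≤ t) (h2 : t < β (n + 1) ω) :
    age α β t ω = t - α n ω := by
  have : IsGreatest {a : ℝ | ∃ k : ℤ, β k ω ≤ t ∧ a = α k ω} (α n ω) := by
    refine ⟨⟨n, h1, rfl⟩, ?_⟩
    rintro _ ⟨k, hk, rfl⟩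
    refine h.monotone_arrival (Int.lt_add_one_iff.1 (not_le.1 fun hle => ?_))
    exact absurd (h2.trans_le (h.monotone_departure hle)) (not_lt.2 hk)
  rw [age, timeStamp, this.csSup_eq]

/-- Inside the interval the age is `t - α n ω`, so a translation reduces the integral to one from
the delay to the next peak; the endpoints are negligible. -/
lemma integral_age (h : IsFCFSPath α β H ω) (n : ℤ) (x : ℝ) :
    ∫ t in β n ω..β (n + 1) ω, (Set.Iic x).indicator (fun _ => (1 : ℝ)) (age α β t ω)
      = min (peakAge α β (n + 1) ω) x - min (delay α β n ω) x := by
  have hle : β n ω ≤ β (n + 1) ω := h.monotone_departure (by simp)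
  have h1 : ∫ t in β n ω..β (n + 1) ω, (Set.Iic x).indicator (fun _ => (1 : ℝ)) (age α β t ω)
      = ∫ t in β n ω..β (n + 1) ω, (Set.Iic x).indicator (fun _ => (1 : ℝ)) (t - α n ω) :=
    intervalIntegral.integral_congr_Ioo_of_le hle fun t ht => by
      simp only [h.age_eq ht.1.le ht.2]
  rw [h1, intervalIntegral.integral_comp_sub_right
    (fun t => (Set.Iic x).indicator (fun _ => (1 : ℝ)) t),
    intervalIntegral_indicator_Iic (sub_le_sub_right hle _), peakAge, add_sub_cancel_right, delay]

end IsFCFSPath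

/-! ### Joint measurability of the age in time and sample point. -/

open Classical in
/-- The age, replaced by `t` where some packet departs before it arrives. -/
def ageVersion (α β : ℤ → Ω → ℝ) (p : ℝ × Ω) : ℝ :=
  if ∀ n, α n p.2 ≤ β n p.2 then age α β p.1 p.2 else p.1

lemma measurable_ageVersion [MeasurableSpace Ω] (hα : ∀ n, Measurable (α n))
    (hβ : ∀ n, Measurable (β n)) : Measurable (ageVersion α β) := by
  classical
  set S : Set (ℝ × Ω) := {p | ∀ n, α n p.2 ≤ β n p.2} with hS
  have hSm : MeasurableSet S := by
    rw [hS, Set.ofPred_forall]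
    exact MeasurableSet.iInter fun n => measurableSet_le ((hα n).comp measurable_snd)
      ((hβ n).comp measurable_snd)
  have hdep : ∀ n, MeasurableSet {p : ℝ × Ω | β n p.2 ≤ p.1} := fun n =>
    measurableSet_le ((hβ n).comp measurable_snd) measurable_fst
  set V : ℝ × Ω → ℝ := fun p => if p ∈ S then timeStamp α β p.1 p.2 else 0 with hV
  have hVm : Measurable V := by
    -- On `S` the time stamps in question are bounded by the time, so their supremum exceeds `c`
    -- exactly when one of them does. The sets with `c < 0` come from the value 0 of `V` off `S` and
    -- of `sSup ∅` when no packet has departed.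
    refine measurable_of_Ioi fun c => ?_
    have : V ⁻¹' Set.Ioi c = (S ∩ ((⋃ n, ({p : ℝ × Ω | β n p.2 ≤ p.1} ∩ {p | c < α n p.2})) ∪
        ((⋃ n, {p : ℝ × Ω | β n p.2 ≤ p.1})ᶜ ∩ {_p | c < 0}))) ∪ (Sᶜ ∩ {_p | c < 0}) := by
      ext p
      by_cases hp : p ∈ S
      · simp only [hV, Set.mem_preimage, hp, if_true, Set.mem_Ioi, Set.mem_union, Set.mem_inter_iff,
          true_and, Set.mem_iUnion, Set.mem_ofPred_eq, Set.mem_compl_iff, not_true_eq_false,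
          false_and, or_false, not_exists]
        by_cases hne : ∃ n, β n p.2 ≤ p.1
        · have hbdd : BddAbove {a : ℝ | ∃ n : ℤ, β n p.2 ≤ p.1 ∧ a = α n p.2} :=
            ⟨p.1, by rintro _ ⟨n, hn, rfl⟩; exact (hp n).trans hn⟩
          obtain ⟨m, hm⟩ := hne
          rw [timeStamp, lt_csSup_iff hbdd ⟨_, m, hm, rfl⟩]
          constructor
          · rintro ⟨_, ⟨n, hn, rfl⟩, hc⟩
            exact Or.inl ⟨n, hn, hc⟩
          · rintro (⟨n, hn, hc⟩ | ⟨hno, _⟩)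
            · exact ⟨_, ⟨n, hn, rfl⟩, hc⟩
            · exact absurd hm (hno m)
        · have hempty : {a : ℝ | ∃ n : ℤ, β n p.2 ≤ p.1 ∧ a = α n p.2} = ∅ :=
            Set.eq_empty_of_forall_notMem fun a ⟨n, hn, _⟩ => hne ⟨n, hn⟩
          rw [timeStamp, hempty, Real.sSup_empty]
          push Not at hne
          constructor
          · exact fun hc => Or.inr ⟨fun n => not_le.2 (hne n), hc⟩
          · rintro (⟨n, hn, _⟩ | ⟨_, hc⟩)
            · exact absurd hn (not_le.2 (hne n))
            · exact hc
      · simp [hV, hp]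
    rw [this]
    exact (hSm.inter ((MeasurableSet.iUnion fun n => (hdep n).inter
      (measurableSet_lt measurable_const ((hα n).comp measurable_snd))).union
      ((MeasurableSet.iUnion hdep).compl.inter (MeasurableSet.const _)))).union
      (hSm.compl.inter (MeasurableSet.const _))
  have : ageVersion α β = fun p => p.1 - V p := by
    ext p
    by_cases hp : p ∈ S
    · have hp' : ∀ n, α n p.2 ≤ β n p.2 := hp
      simp only [ageVersion, hV, hp, if_true, age]
      rw [if_pos hp']
    · have hp' : ¬ ∀ n, α n p.2 ≤ β n p.2 := hp
      simp only [ageVersion, hV, hp, if_false, sub_zero]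
      rw [if_neg hp']
  rw [this]
  exact measurable_fst.sub hVm

lemma IsFCFSPath.ageVersion_eq (h : IsFCFSPath α β H ω) (t : ℝ) :
    ageVersion α β (t, ω) = age α β t ω :=
  if_pos h.arrival_le_departure

end Path

/-! ### The law of the inputs -/

section Queue

variable {Ω : Type*} [MeasurableSpace Ω] {P : Measure Ω}
  {μG μH : Measure ℝ} {α β H : ℤ → Ω → ℝ}

lemma IsFCFSQueue.measurable_interarrival (hQ : IsFCFSQueue P μG μH α β H) (n : ℤ) :
    Measurable (interarrival α n) :=
  (hQ.measurable_arrival n).sub (hQ.measurable_arrival (n - 1))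

lemma IsFCFSQueue.measurable_inputs (hQ : IsFCFSQueue P μG μH α β H) :
    Measurable (inputs α H) :=
  measurable_pi_lambda _ fun k =>
    (hQ.measurable_interarrival (k + 2)).prodMk (hQ.measurable_service (k + 2))

/-- The relevant variables form an independent family over `ℕ × Bool`, with `true` for interarrival
times; currying its product law and reading off the two Booleans yields i.i.d. pairs. -/
lemma IsFCFSQueue.map_inputs [IsProbabilityMeasure μG]
    [IsProbabilityMeasure μH] (hQ : IsFCFSQueue P μG μH α β H) : P.map (inputs α H) = seqLaw (μG.prod μH) := by
  set idx : ℕ × Bool → {n : ℤ // n ≠ 1} ⊕ ℤ := fun p =>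
    if p.2 then Sum.inl ⟨p.1 + 2, by omega⟩ else Sum.inr (p.1 + 2) with hidx
  have hinj : Function.Injective idx := by
    rintro ⟨k, a⟩ ⟨l, b⟩ h
    cases a <;> cases b <;> simp [hidx] at h ⊢ <;> omega
  set X : ℕ × Bool → Ω → ℝ := fun p =>
    if p.2 then interarrival α (p.1 + 2) else H (p.1 + 2) with hX
  have hXm : ∀ p, Measurable (X p) := by
    rintro ⟨k, a⟩
    cases a
    · exact hQ.measurable_service _
    · exact hQ.measurable_interarrival _
  have hXind : iIndepFun X P := by
    have := hQ.indep.precomp hinj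
    convert this using 1
    ext ⟨k, a⟩ ω
    cases a <;> rfl
  set μ : ℕ → Bool → Measure ℝ := fun _ a => if a then μG else μH with hμ
  have hμp : ∀ k a, IsProbabilityMeasure (μ k a) := by
    intro k a
    cases a
    · exact ‹IsProbabilityMeasure μH›
    · exact ‹IsProbabilityMeasure μG›
  have hXlaw : ∀ p, P.map (X p) = μ p.1 p.2 := by
    rintro ⟨k, a⟩
    cases a
    · exact (hQ.service_law _).map_eq
    · exact (hQ.interarrival_law _ (by omega)).map_eq
  have h1 : P.map (fun ω p => X p ω) = Measure.infinitePi fun p : ℕ × Bool => μ p.1 p.2 := by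
    rw [hXind.map_fun_eq_infinitePi_map hXm]
    simp only [hXlaw]
  have hpair : Measurable fun w : Bool → ℝ => (w true, w false) :=
    (measurable_pi_apply true).prodMk (measurable_pi_apply false)
  have h2 : inputs α H = (fun (w : ℕ → Bool → ℝ) k => (w k true, w k false)) ∘
      (MeasurableEquiv.curry ℕ Bool ℝ) ∘ fun ω p => X p ω := rfl
  have h3 : Measurable fun ω p => X p ω := measurable_pi_lambda _ hXm
  have h4 : Measurable fun (w : ℕ → Bool → ℝ) k => (w k true, w k false) :=
    measurable_pi_lambda _ fun k => hpair.comp (measurable_pi_apply k)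
  rw [h2, ← Measure.map_map h4 ((MeasurableEquiv.measurable _).comp h3), ← Measure.map_map (MeasurableEquiv.measurable _) h3,
    h1, Measure.infinitePi_map_curry μ,
    Measure.infinitePi_map_pi (fun k : ℕ => Measure.infinitePi fun a : Bool => μ k a)
      (f := fun _ w => (w true, w false)) fun _ => hpair]
  congr 1
  ext1 k
  exact Measure.infinitePi_map_eval_prod (P := fun a : Bool => μ k a) (by decide)

lemma IsFCFSQueue.ae_isFCFSPath (hQ : IsFCFSQueue P μG μH α β H) :
    ∀ᵐ ω ∂P, IsFCFSPath α β H ω := by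
  filter_upwards [hQ.arrival_mono, hQ.service_nonneg, hQ.fcfs] with ω a b c using ⟨a, b, c⟩

lemma IsFCFSQueue.ae_interarrival_nonneg (hQ : IsFCFSQueue P μG μH α β H) :
    ∀ᵐ x ∂μG, 0 ≤ x := by
  rw [← (hQ.interarrival_law 2 (by norm_num)).map_eq,
    ae_map_iff (hQ.measurable_interarrival 2).aemeasurable measurableSet_Ici]
  filter_upwards [hQ.arrival_mono] with ω h using sub_nonneg.2 (h 2)

lemma IsFCFSQueue.ae_service_nonneg (hQ : IsFCFSQueue P μG μH α β H) :
    ∀ᵐ x ∂μH, 0 ≤ x := by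
  rw [← (hQ.service_law 0).map_eq,
    ae_map_iff (hQ.measurable_service 0).aemeasurable measurableSet_Ici]
  filter_upwards [hQ.service_nonneg] with ω h using h 0

/-! ### Asymptotic frequencies -/

lemma integral_indicator_Iic_comp {X : Type*} [MeasurableSpace X] {ν : Measure X}
    [IsProbabilityMeasure ν] {f : X → ℝ} (hf : Measurable f) (x : ℝ) :
    ∫ q, (Set.Iic x).indicator (fun _ => (1 : ℝ)) (f q) ∂ν = cdf (ν.map f) x := by
  have := Measure.isProbabilityMeasure_map (μ := ν) hf.aemeasurable
  rw [cdf_eq_real, ← integral_map hf.aemeasurable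
    (measurable_indicator_Iic x).aestronglyMeasurable,
    integral_indicator_const _ measurableSet_Iic, smul_eq_mul, mul_one]

lemma hasSeqFrequency_iff {u : ℤ → ℝ} {ν : Measure ℝ} : HasSeqFrequency u ν ↔ ∀ x, Tendsto
    (fun N : ℕ => (∑ k ∈ Finset.range N,
      (Set.Iic x).indicator (fun _ => (1 : ℝ)) (u (k + 1))) / N) atTop (𝓝 (cdf ν x)) := by
  refine forall_congr' fun x => tendsto_congr fun N => ?_
  rw [one_div, inv_mul_eq_div, ← Finset.Ico_add_one_right_eq_Icc, Finset.sum_Ico_eq_sum_range]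
  simp only [Nat.add_sub_cancel, Nat.cast_add, Nat.cast_one, add_comm (1 : ℤ)]

lemma abs_min_sub_min_le {a b : ℝ} (ha : 0 ≤ a) (hb : 0 ≤ b) (x : ℝ) :
    |min a x - min b x| ≤ |x| := by
  rcases le_total 0 x with hx | hx
  · rw [abs_of_nonneg hx, abs_le]
    have h1 := le_min ha hx
    have h2 := le_min hb hx
    have h3 := min_le_right a x
    have h4 := min_le_right b x
    constructor <;> linarith
  · rw [min_eq_right (hx.trans ha), min_eq_right (hx.trans hb), sub_self, abs_zero]
    exact abs_nonneg x

variable [IsProbabilityMeasure μG] [IsProbabilityMeasure μH]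
  (hQ : IsFCFSQueue P μG μH α β H) (h0 : ∀ᵐ p ∂μG.prod μH, 0 ≤ p.1 ∧ 0 ≤ p.2)
  (h1 : Integrable (fun p => p.1) (μG.prod μH)) (h2 : Integrable (fun p => p.2) (μG.prod μH))
  (h12 : ∫ p, p.2 ∂μG.prod μH < ∫ p, p.1 ∂μG.prod μH)

include hQ h0 h1 h2 h12

/-- The delay of packet 1 may be correlated with the later inputs. This is harmless, since the
exceptional null set of `ae_tendsto_avg_delayPath` serves all initial delays. -/
lemma IsFCFSQueue.ae_tendsto_avg {φ : ℝ × (ℝ × ℝ) → ℝ} (hφ : Measurable φ) {C : ℝ}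
    (hC : ∀ q, |φ q| ≤ C) :
    ∀ᵐ ω ∂P, Tendsto (fun n : ℕ => (∑ k ∈ Finset.range n,
      φ (delayPath (delay α β 1 ω) (inputs α H ω) k, inputs α H ω k)) / n) atTop
      (𝓝 (∫ q, φ q ∂stateLaw (μG.prod μH))) := by
  have h3 := ae_tendsto_avg_delayPath h0 h1 h2 h12 hφ hC
  rw [← hQ.map_inputs] at h3
  filter_upwards [ae_of_ae_map hQ.measurable_inputs.aemeasurable h3] with ω hω using hω _

theorem IsFCFSQueue.ae_hasSeqFrequency_delay :
    ∀ᵐ ω ∂P, HasSeqFrequency (fun n => delay α β n ω) (delayLaw (μG.prod μH)) := by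
  simp only [hasSeqFrequency_iff]
  refine ae_forall_tendsto_of_monotone (F := fun ω N x => (∑ k ∈ Finset.range N,
      (Set.Iic x).indicator (fun _ => (1 : ℝ)) (delay α β (k + 1) ω)) / N) ?_
    (monotone_cdf _) fun x => ?_
  · exact Eventually.of_forall fun ω => Eventually.of_forall fun N x y hxy =>
      div_le_div_of_nonneg_right (Finset.sum_le_sum fun k _ => indicator_Iic_mono _ hxy)
        (Nat.cast_nonneg N)
  · have h3 := hQ.ae_tendsto_avg h0 h1 h2 h12
      ((measurable_indicator_Iic x).comp (measurable_fst (β := ℝ × ℝ)))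
      fun q => abs_indicator_Iic_le_one x q.1
    have h4 : ∫ q : ℝ × (ℝ × ℝ), ((Set.Iic x).indicator fun _ => (1 : ℝ)) q.1
        ∂stateLaw (μG.prod μH) = cdf (delayLaw (μG.prod μH)) x := by
      rw [integral_indicator_Iic_comp measurable_fst, measurePreserving_fst.map_eq]
    simp only [Function.comp_apply] at h3
    rw [h4] at h3
    filter_upwards [h3, hQ.ae_isFCFSPath] with ω hω hp
    simpa only [hp.delay_eq_delayPath] using hω

theorem IsFCFSQueue.ae_hasSeqFrequency_peakAge :
    ∀ᵐ ω ∂P, HasSeqFrequency (fun n => peakAge α β n ω) (peakLaw (μG.prod μH)) := by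
  simp only [hasSeqFrequency_iff]
  refine ae_forall_tendsto_of_monotone (F := fun ω N x => (∑ k ∈ Finset.range N,
      (Set.Iic x).indicator (fun _ => (1 : ℝ)) (peakAge α β (k + 1) ω)) / N) ?_
    (monotone_cdf _) fun x => ?_
  · exact Eventually.of_forall fun ω => Eventually.of_forall fun N x y hxy =>
      div_le_div_of_nonneg_right (Finset.sum_le_sum fun k _ => indicator_Iic_mono _ hxy)
        (Nat.cast_nonneg N)
  · have h3 := hQ.ae_tendsto_avg h0 h1 h2 h12
      ((measurable_indicator_Iic x).comp measurable_peakOf)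
      fun q => abs_indicator_Iic_le_one x (peakOf q)
    simp only [Function.comp_apply] at h3
    rw [integral_indicator_Iic_comp measurable_peakOf] at h3
    filter_upwards [h3, hQ.ae_isFCFSPath] with ω hω hp
    simp only [← hp.peakAge_eq] at hω
    -- The path describes peaks from packet 2 on, the frequency counts from packet 1; this shift
    -- changes a sum of indicators by at most 2.
    refine tendsto_avg_congr (K := 2 * 1) (fun n => ?_) hω
    rw [abs_sub_comm]
    refine le_of_eq_of_le ?_ (abs_sum_sub_sum_succ_le (u := fun k : ℕ =>
      (Set.Iic x).indicator (fun _ => (1 : ℝ)) (peakAge α β (k + 1) ω))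
      (fun k => abs_indicator_Iic_le_one x _) n)
    push_cast
    simp only [add_assoc, one_add_one_eq_two]

theorem IsFCFSQueue.ae_hasTimeFrequency_age (hpos : 0 < ∫ p, p.1 ∂μG.prod μH) :
    ∀ᵐ ω ∂P, HasTimeFrequency (fun t => age α β t ω) (ageLaw (μG.prod μH)) := by
  have hmeas : ∀ ω, IsFCFSPath α β H ω → Measurable fun t => age α β t ω := fun ω hp => by
    simp only [← hp.ageVersion_eq]
    exact (measurable_ageVersion hQ.measurable_arrival hQ.measurable_departure).comp
      measurable_prodMk_right
  refine ae_forall_tendsto_of_monotone (F := fun ω T x => (1 / T) * ∫ t in (0 : ℝ)..T,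
      (Set.Iic x).indicator (fun _ => (1 : ℝ)) (age α β t ω)) ?_ (monotone_cdf _) fun x => ?_
  · filter_upwards [hQ.ae_isFCFSPath] with ω hp
    filter_upwards [eventually_ge_atTop 0] with T hT x y hxy
    exact mul_le_mul_of_nonneg_left (intervalIntegral.integral_mono_on hT
      (intervalIntegrable_indicator_Iic (hmeas ω hp) x 0 T)
      (intervalIntegrable_indicator_Iic (hmeas ω hp) y 0 T)
      fun t _ => indicator_Iic_mono _ hxy) (by positivity)
  -- The truncation at 0 is almost surely void, but it makes `φ` bounded by `|x|` everywhere.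
  · set φ : ℝ × (ℝ × ℝ) → ℝ := fun q => min (max (peakOf q) 0) x - min (max q.1 0) x with hφ
    have hφm : Measurable φ := by fun_prop
    have h3 := hQ.ae_tendsto_avg h0 h1 h2 h12 hφm
      fun q => abs_min_sub_min_le (le_max_right (peakOf q) 0) (le_max_right q.1 0) x
    have h4 : ∫ q, φ q ∂stateLaw (μG.prod μH)
        = ∫ q, (min (peakOf q) x - min q.1 x) ∂stateLaw (μG.prod μH) := by
      refine integral_congr_ae ?_
      filter_upwards [ae_stateLaw_nonneg h0 h1 h2 h12, ae_delay_le_peakOf h0 h1 h2 h12]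
        with q a b
      simp only [hφ]
      rw [max_eq_left a.1, max_eq_left (a.1.trans b)]
    have htyp := ae_isTypical h0 h1 h2
    rw [← hQ.map_inputs] at htyp
    filter_upwards [h3, hQ.ae_isFCFSPath,
      ae_of_ae_map hQ.measurable_inputs.aemeasurable htyp] with ω hω hp hz
    set f : ℝ → ℝ := fun t => (Set.Iic x).indicator (fun _ => (1 : ℝ)) (age α β t ω) with hf
    have hfint : ∀ a b, IntervalIntegrable f volume a b :=
      intervalIntegrable_indicator_Iic (hmeas ω hp) x
    have hterm : ∀ k : ℕ, ∫ t in β (k + 1) ω..β ((k + 1 : ℕ) + 1) ω, f t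
        = φ (delayPath (delay α β 1 ω) (inputs α H ω) k, inputs α H ω k) := by
      intro k
      push_cast
      have hpk := hp.peakAge_eq k
      have hle : delay α β (k + 1) ω ≤ peakAge α β (k + 1 + 1) ω := by
        rw [delay, peakAge, add_sub_cancel_right]
        exact sub_le_sub_right (hp.monotone_departure (by simp)) _
      have hd := hp.delay_nonneg (k + 1)
      simp only [hf, hφ]
      rw [hp.integral_age, ← hpk, ← hp.delay_eq_delayPath]
      rw [show (k : ℤ) + 1 + 1 = k + 2 by ring] at hle ⊢
      rw [max_eq_left hd, max_eq_left (hd.trans hle)]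
    have hsum : ∀ n : ℕ, ∫ t in (0 : ℝ)..β (n + 1) ω, f t = (∫ t in (0 : ℝ)..β 1 ω, f t) +
        ∑ k ∈ Finset.range n,
          φ (delayPath (delay α β 1 ω) (inputs α H ω) k, inputs α H ω k) := by
      intro n
      have h5 := intervalIntegral.sum_integral_adjacent_intervals (μ := volume) (f := f)
        (a := fun k : ℕ => β (k + 1) ω) (n := n) fun k _ => hfint _ _
      simp only [hterm] at h5
      rw [h5, Nat.cast_zero, zero_add, intervalIntegral.integral_add_adjacent_intervals
        (hfint _ _) (hfint _ _)]
    have hmono : Monotone fun T => ∫ t in (0 : ℝ)..T, f t := by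
      intro S T hST
      have h6 : 0 ≤ ∫ t in S..T, f t :=
        intervalIntegral.integral_nonneg hST fun t _ => indicator_Iic_nonneg x _
      simp only
      rw [← intervalIntegral.integral_add_adjacent_intervals (hfint 0 S) (hfint S T)]
      exact le_add_of_nonneg_right h6
    -- The limit along departure epochs passes to continuous time because the integral is monotone
    -- in its upper limit and `β (n + 1) ω / n` tends to `E[G]`.
    have hlim := tendsto_div_of_monotone_of_seq hmono hpos (hp.tendsto_departure_div hz h12)
      (c := ∫ q, φ q ∂stateLaw (μG.prod μH)) (by
        have h7 := (tendsto_const_div_atTop_nhds_zero_nat (∫ t in (0 : ℝ)..β 1 ω, f t)).add hω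
        rw [zero_add] at h7
        refine h7.congr fun n => ?_
        rw [hsum, add_div])
    rw [h4, ← cdf_ageLaw h0 h1 h2 h12 hpos] at hlim
    refine hlim.congr fun T => ?_
    rw [one_div, inv_mul_eq_div]

end Queue

end AoI

end

/-! ### Assembly of the stationary laws, the frequencies and the formulas. -/

theorem lemma3 {Ω : Type*} [MeasurableSpace Ω] (P : Measure Ω) [IsProbabilityMeasure P]
    (μG μH : Measure ℝ) (α β H : ℤ → Ω → ℝ)
    (hQ : AoI.IsFCFSQueue P μG μH α β H)
    (hG : Integrable (fun x : ℝ => x) μG) (hH : Integrable (fun x : ℝ => x) μH)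
    (hG_pos : 0 < ∫ x, x ∂μG)
    (hρ : (∫ x, x ∂μH) / (∫ x, x ∂μG) < 1) :
    -- laws of the stationary system delay `D`, AoI `A` and peak AoI
    ∃ μD μA μPeak : Measure ℝ,
      (IsProbabilityMeasure μD ∧ μD (Set.Iio 0) = 0) ∧
      (IsProbabilityMeasure μA ∧ μA (Set.Iio 0) = 0) ∧
      (IsProbabilityMeasure μPeak ∧ μPeak (Set.Iio 0) = 0) ∧
      -- they are the asymptotic frequency distributions on almost every sample path
      (∀ᵐ ω ∂P, AoI.HasSeqFrequency (fun n => AoI.delay α β n ω) μD ∧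
        AoI.HasTimeFrequency (fun t => AoI.age α β t ω) μA ∧
        AoI.HasSeqFrequency (fun n => AoI.peakAge α β n ω) μPeak) ∧
      -- they are the laws of `D_n`, `A_t` and the `n`-th peak AoI wherever these are stationary
      ((∀ n, 1 ≤ n → IdentDistrib (AoI.delay α β n) (AoI.delay α β 1) P P) →
        ∀ n, 1 ≤ n → HasLaw (AoI.delay α β n) μD P) ∧
      ((∀ t, 0 ≤ t → IdentDistrib (AoI.age α β t) (AoI.age α β 0) P P) →
        ∀ t, 0 ≤ t → HasLaw (AoI.age α β t) μA P) ∧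
      ((∀ n, 1 ≤ n → IdentDistrib (AoI.peakAge α β n) (AoI.peakAge α β 1) P P) →
        ∀ n, 1 ≤ n → HasLaw (AoI.peakAge α β n) μPeak P) ∧
      -- the two formulas
      ∀ s : ℝ, 0 < s →
        AoI.lst μA s = (AoI.lst μD s - AoI.lst μPeak s) / (s * ∫ x, x ∂μG) ∧
        AoI.lst μPeak s =
          ((∫ x, Real.exp (-s * x) * cdf μG x ∂μD)
            + (∫ x, Real.exp (-s * x) * cdf μD x ∂μG)
            - ∫ p : ℝ × ℝ, Set.indicator {q : ℝ × ℝ | q.1 = q.2}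
                (fun q => Real.exp (-s * q.1)) p ∂(μG.prod μD))
          * AoI.lst μH s := by
  have hGp : IsProbabilityMeasure μG :=
    (hQ.interarrival_law 2 (by norm_num)).isProbabilityMeasure_iff.1 inferInstance
  have hHp : IsProbabilityMeasure μH :=
    (hQ.service_law 0).isProbabilityMeasure_iff.1 inferInstance
  have hG0 := hQ.ae_interarrival_nonneg
  have h0 : ∀ᵐ p ∂μG.prod μH, 0 ≤ p.1 ∧ 0 ≤ p.2 :=
    (Measure.quasiMeasurePreserving_fst.ae hG0).and
      (Measure.quasiMeasurePreserving_snd.ae hQ.ae_service_nonneg)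
  have h1 : Integrable (fun p => p.1) (μG.prod μH) := hG.comp_fst μH
  have h2 : Integrable (fun p => p.2) (μG.prod μH) := hH.comp_snd μG
  have e1 : ∫ p, p.1 ∂μG.prod μH = ∫ x, x ∂μG := by
    rw [integral_fun_fst (fun x : ℝ => x), probReal_univ, one_smul]
  have e2 : ∫ p, p.2 ∂μG.prod μH = ∫ x, x ∂μH := by
    rw [integral_fun_snd (fun x : ℝ => x), probReal_univ, one_smul]
  have h12 : ∫ p, p.2 ∂μG.prod μH < ∫ p, p.1 ∂μG.prod μH := by
    rw [e1, e2]
    exact (div_lt_one hG_pos).1 hρ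
  have hpos : 0 < ∫ p, p.1 ∂μG.prod μH := by rwa [e1]
  have hAge := AoI.isProbabilityMeasure_ageLaw h0 h1 h2 h12 hpos
  have hD0 := AoI.ae_delayLaw_nonneg h0 h1 h2 h12
  have hP0 := AoI.ae_peakLaw_nonneg h0 h1 h2 h12
  have fD := hQ.ae_hasSeqFrequency_delay h0 h1 h2 h12
  have fA := hQ.ae_hasTimeFrequency_age h0 h1 h2 h12 hpos
  have fP := hQ.ae_hasSeqFrequency_peakAge h0 h1 h2 h12
  have null : ∀ ν : Measure ℝ, (∀ᵐ x ∂ν, 0 ≤ x) → ν (Set.Iio 0) = 0 := fun ν h =>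
    measure_mono_null (fun x hx => not_le.2 hx) (ae_iff.1 h)
  refine ⟨AoI.delayLaw (μG.prod μH), AoI.ageLaw (μG.prod μH), AoI.peakLaw (μG.prod μH),
    ⟨inferInstance, null _ hD0⟩, ⟨hAge, AoI.ageLaw_Iio_zero h0 h1 h2 h12⟩,
    ⟨inferInstance, null _ hP0⟩, ?_, AoI.hasLaw_of_hasSeqFrequency fD, ?_,
    AoI.hasLaw_of_hasSeqFrequency fP, fun s hs => ⟨?_, AoI.lst_peakLaw hG0 hD0 hs⟩⟩
  · filter_upwards [fD, fA, fP] with ω a b c using ⟨a, b, c⟩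
  · exact AoI.hasLaw_of_hasTimeFrequency
      (AoI.measurable_ageVersion hQ.measurable_arrival hQ.measurable_departure)
      (hQ.ae_isFCFSPath.mono fun ω h t => (h.ageVersion_eq t).symm) fA
  · rw [AoI.lst_ageLaw h0 h1 h2 h12 hs, e1]
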